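/- Let $N\ge 1$, let $A_N=\mathbb{C}[t]/(t^N)$, and let $V$, $W$ be finite-dimensional complex vector spaces. Let $X^{(N)}_{\dim V,\dim W}$ be the Grassmannian of $\dim V$-dimensional $A_N$-submodules of $W\otimes_{\mathbb{C}} A_N$, with its structure of a (reduced) subvariety of the Grassmannian of $\dim V$-dimensional subspaces of $W\otimes A_N$. Let $(\mathcal{N}^{(N)}(V)\times\mathrm{Hom}(V,W))^{\mathrm{st}}$ be the subvariety of $\mathrm{End}(V)\times\mathrm{Hom}(V,W)$ of all stable pairs $(\varphi,f)$ with $\varphi^N=0$, where $(\varphi,f)$ is stable if $\bigcap_{i\ge 0}\ker(f\varphi^i)=0$, and let $\mathrm{GL}(V)$ act on it by $g\cdot(\varphi,f)=(g\varphi g^{-1},fg^{-1})$. Then this action admits a geometric quotient, and the variety $X^{(N)}_{\dim V,\dim W}$ is isomorphic to it: $$X^{(N)}_{\dim V,\dim W}\;\simeq\;(\mathcal{N}^{(N)}(V)\times\mathrm{Hom}(V,W))^{\mathrm{st}}/\mathrm{GL}(V).$$ More precisely, the map $\pi:(\varphi,f)\mapsto \mathrm{Im}\bigl(\sum_{i=0}^{N-1}f\varphi^{N-1-i}t^i: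 V\to W\otimes A_N\bigr)$ takes values in $X^{(N)}_{\dim V,\dim W}$ and is a geometric quotient by $\mathrm{GL}(V)$, and for every geometric quotient $q$ by $\mathrm{GL}(V)$ onto a variety $Q$ there is an isomorphism of varieties $e: X^{(N)}_{\dim V,\dim W}\to Q$ with $e\circ\pi=q$. Here varieties are reduced, separated and of finite type over $\mathbb{C}$, possibly reducible or empty. A geometric quotient of $Z$ by a group $G$ is a surjective open morphism $q:Z\to Q$ onto a variety whose fibres are exactly the $G$-orbits and such that, for every open $U\subseteq Q$, pullback along $q$ identifies the regular functions on $U$ with the $G$-invariant regular functions on $q^{-1}(U)$. -/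

import Mathlib

open scoped TensorProduct Topology

noncomputable section

/-! ## Algebraic varieties over `ℂ` as spaces with functions -/

/-- A space with functions over `ℂ`: a topological space together with a sheaf of `ℂ`-algebras of
`ℂ`-valued functions such that the non-vanishing locus of a section is open and its inverse there
is again a section.  The sheaf is recorded through its germs: `RegularAt x f` says that the
function `f` is a section on some neighbourhood of `x` (the values of `f` far from `x` are
irrelevant), and the sections on an open set `U` are the functions regular at every point of `U`,
see `RegularOn`. -/
structure SpaceWithFunctions.{u} where
  carrier : Type u
  top : TopologicalSpace carrier
  RegularAt : carrier → (carrier → ℂ) → Prop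
  regularAt_const : ∀ (x : carrier) (c : ℂ), RegularAt x (fun _ => c)
  regularAt_add : ∀ (x : carrier) (f g : carrier → ℂ),
    RegularAt x f → RegularAt x g → RegularAt x (fun y => f y + g y)
  regularAt_mul : ∀ (x : carrier) (f g : carrier → ℂ),
    RegularAt x f → RegularAt x g → RegularAt x (fun y => f y * g y)
  regularAt_congr : ∀ (x : carrier) (f g : carrier → ℂ),
    (∀ᶠ y in 𝓝 x, f y = g y) → RegularAt x f → RegularAt x g
  eventually_regularAt : ∀ (x : carrier) (f : carrier → ℂ),
    RegularAt x f → ∀ᶠ y in 𝓝 x, RegularAt y f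
  eventually_ne : ∀ (x : carrier) (f : carrier → ℂ),
    RegularAt x f → f x ≠ 0 → ∀ᶠ y in 𝓝 x, f y ≠ 0
  regularAt_inv : ∀ (x : carrier) (f : carrier → ℂ),
    RegularAt x f → f x ≠ 0 → RegularAt x (fun y => (f y)⁻¹)

namespace SpaceWithFunctions

universe u v w

instance : CoeSort SpaceWithFunctions.{u} (Type u) := ⟨carrier⟩

instance (X : SpaceWithFunctions.{u}) : TopologicalSpace X := X.top

/-- The sections over an open set `U`. -/
def RegularOn (X : SpaceWithFunctions.{u}) (U : Set X) (f : X → ℂ) : Prop :=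
  ∀ x ∈ U, X.RegularAt x f

/-- Morphisms: continuous maps along which regular functions pull back to regular functions. -/
structure IsMorphism {X : SpaceWithFunctions.{u}} {Y : SpaceWithFunctions.{v}} (φ : X → Y) :
    Prop where
  continuous : Continuous φ
  regular : ∀ (x : X) (f : Y → ℂ), Y.RegularAt (φ x) f → X.RegularAt x (fun y => f (φ y))

/-- Isomorphisms of spaces with functions. -/
structure Iso (X : SpaceWithFunctions.{u}) (Y : SpaceWithFunctions.{v}) where
  toEquiv : X ≃ Y
  isMorphism : IsMorphism (toEquiv : X → Y)
  isMorphism_symm : IsMorphism (toEquiv.symm : Y → X)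

/-- The structure induced on a subset: the subspace topology, and the functions that are locally
restrictions of regular functions of the ambient space. -/
def restrict (X : SpaceWithFunctions.{u}) (S : Set X) : SpaceWithFunctions.{u} where
  carrier := S
  top := inferInstance
  RegularAt x f := ∃ F : X → ℂ, X.RegularAt x F ∧ ∀ᶠ y : S in 𝓝 x, f y = F y
  regularAt_const x c := ⟨_, X.regularAt_const x c, .of_forall fun _ => rfl⟩
  regularAt_add := by
    rintro x f g ⟨F, hF, hf⟩ ⟨G, hG, hg⟩
    refine ⟨_, X.regularAt_add x F G hF hG, ?_⟩
    filter_upwards [hf, hg] with y h₁ h₂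
    rw [h₁, h₂]
  regularAt_mul := by
    rintro x f g ⟨F, hF, hf⟩ ⟨G, hG, hg⟩
    refine ⟨_, X.regularAt_mul x F G hF hG, ?_⟩
    filter_upwards [hf, hg] with y h₁ h₂
    rw [h₁, h₂]
  regularAt_congr := by
    rintro x f g hfg ⟨F, hF, hf⟩
    refine ⟨F, hF, ?_⟩
    filter_upwards [hfg, hf] with y h₁ h₂
    rw [← h₁, h₂]
  eventually_regularAt := by
    rintro x f ⟨F, hF, hf⟩
    have h := (continuous_subtype_val (p := (· ∈ S))).continuousAt.eventually
      (X.eventually_regularAt x F hF)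
    filter_upwards [h, hf.eventually_nhds] with y h₁ h₂
    exact ⟨F, h₁, h₂⟩
  eventually_ne := by
    rintro x f ⟨F, hF, hf⟩ hx
    have h := (continuous_subtype_val (p := (· ∈ S))).continuousAt.eventually
      (X.eventually_ne x F hF (hf.self_of_nhds ▸ hx))
    filter_upwards [h, hf] with y h₁ h₂
    rwa [h₂]
  regularAt_inv := by
    rintro x f ⟨F, hF, hf⟩ hx
    refine ⟨_, X.regularAt_inv x F hF (hf.self_of_nhds ▸ hx), ?_⟩
    filter_upwards [hf] with y h
    rw [h]

end SpaceWithFunctions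

section AffineSpace

universe u

variable (E : Type u) [AddCommGroup E] [Module ℂ E]

/-- The algebra of polynomial functions on a vector space: the algebra of functions generated by
the linear forms. -/
def polyFunctions : Subalgebra ℂ (E → ℂ) :=
  Algebra.adjoin ℂ (Set.range fun l : E →ₗ[ℂ] ℂ => (l : E → ℂ))

/-- The Zariski topology on a vector space, with basis the principal open sets `{p ≠ 0}`. -/
abbrev zariskiTopology : TopologicalSpace E :=
  TopologicalSpace.generateFrom {U | ∃ p ∈ polyFunctions E, U = {x | p x ≠ 0}}

variable {E} in
theorem eventually_ne_of_mem_polyFunctions {p : E → ℂ} (hp : p ∈ polyFunctions E)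
    {x : E} (hx : p x ≠ 0) : ∀ᶠ y in @nhds E (zariskiTopology E) x, p y ≠ 0 :=
  letI := zariskiTopology E
  IsOpen.mem_nhds (TopologicalSpace.isOpen_generateFrom_of_mem ⟨p, hp, rfl⟩) hx

/-- A finite-dimensional vector space as an affine variety: the regular functions are those that
are locally quotients of polynomial functions. -/
def affineSpace [Module.Finite ℂ E] : SpaceWithFunctions.{u} where
  carrier := E
  top := zariskiTopology E
  RegularAt x f := ∃ p ∈ polyFunctions E, ∃ q ∈ polyFunctions E, q x ≠ 0 ∧
    ∀ᶠ y in @nhds E (zariskiTopology E) x, f y = p y / q y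
  regularAt_const x c := ⟨algebraMap ℂ _ c, Subalgebra.algebraMap_mem _ c, 1,
    Subalgebra.one_mem _, by simp, .of_forall fun _ => by simp⟩
  regularAt_add := by
    rintro x f g ⟨p, hp, q, hq, hx, hf⟩ ⟨p', hp', q', hq', hx', hg⟩
    refine ⟨p * q' + q * p', Subalgebra.add_mem _ (Subalgebra.mul_mem _ hp hq')
      (Subalgebra.mul_mem _ hq hp'), q * q', Subalgebra.mul_mem _ hq hq', mul_ne_zero hx hx', ?_⟩
    filter_upwards [hf, hg, eventually_ne_of_mem_polyFunctions hq hx,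
      eventually_ne_of_mem_polyFunctions hq' hx'] with y h₁ h₂ h₃ h₄
    rw [h₁, h₂, div_add_div _ _ h₃ h₄]
    rfl
  regularAt_mul := by
    rintro x f g ⟨p, hp, q, hq, hx, hf⟩ ⟨p', hp', q', hq', hx', hg⟩
    refine ⟨p * p', Subalgebra.mul_mem _ hp hp', q * q', Subalgebra.mul_mem _ hq hq',
      mul_ne_zero hx hx', ?_⟩
    filter_upwards [hf, hg] with y h₁ h₂
    rw [h₁, h₂, div_mul_div_comm]
    rfl
  regularAt_congr := by
    rintro x f g hfg ⟨p, hp, q, hq, hx, hf⟩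
    refine ⟨p, hp, q, hq, hx, ?_⟩
    filter_upwards [hfg, hf] with y h₁ h₂
    rw [← h₁, h₂]
  eventually_regularAt := by
    rintro x f ⟨p, hp, q, hq, hx, hf⟩
    let := zariskiTopology E
    filter_upwards [hf.eventually_nhds, eventually_ne_of_mem_polyFunctions hq hx]
      with y h₁ h₂
    exact ⟨p, hp, q, hq, h₂, h₁⟩
  eventually_ne := by
    rintro x f ⟨p, hp, q, hq, hx, hf⟩ hfx
    let := zariskiTopology E
    have hpx : p x ≠ 0 := fun h => hfx (by rw [hf.self_of_nhds, h, zero_div])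
    filter_upwards [hf, eventually_ne_of_mem_polyFunctions hq hx,
      eventually_ne_of_mem_polyFunctions hp hpx] with y h₁ h₂ h₃
    rw [h₁]
    exact div_ne_zero h₃ h₂
  regularAt_inv := by
    rintro x f ⟨p, hp, q, hq, hx, hf⟩ hfx
    let := zariskiTopology E
    have hpx : p x ≠ 0 := fun h => hfx (by rw [hf.self_of_nhds, h, zero_div])
    refine ⟨q, hq, p, hp, hpx, ?_⟩
    filter_upwards [hf] with y h₁
    rw [h₁, inv_div]

end AffineSpace

namespace SpaceWithFunctions

universe u v

/-- Affine varieties: spaces isomorphic to a Zariski closed subset of some `ℂⁿ`. -/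
def IsAffine (X : SpaceWithFunctions.{u}) : Prop :=
  ∃ (n : ℕ) (S : Set (affineSpace (Fin n → ℂ))), IsClosed S ∧
    Nonempty (Iso X ((affineSpace (Fin n → ℂ)).restrict S))

/-- Varieties over `ℂ` (possibly reducible or empty): separated spaces with functions having a
finite open cover by affine varieties. -/
structure IsVariety (X : SpaceWithFunctions.{u}) : Prop where
  exists_affine_cover : ∃ 𝒰 : Set (Set X), 𝒰.Finite ∧ ⋃₀ 𝒰 = Set.univ ∧
    ∀ U ∈ 𝒰, IsOpen U ∧ (X.restrict U).IsAffine
  separated : ∀ (Y : SpaceWithFunctions.{u}) (φ ψ : Y → X), IsMorphism φ → IsMorphism ψ →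
    IsClosed {y | φ y = ψ y}

/-- `q : Z → Q` is a geometric quotient of `Z` by the group `G`: `Q` is a variety, `q` is a
surjective open morphism whose fibres are exactly the `G`-orbits, and the regular functions on an
open `U ⊆ Q` are the `G`-invariant regular functions on `q⁻¹(U)`. -/
structure IsGeometricQuotient (G : Type*) [Group G] {Z : SpaceWithFunctions.{u}} [MulAction G Z]
    {Q : SpaceWithFunctions.{v}} (q : Z → Q) : Prop where
  isVariety : Q.IsVariety
  isMorphism : IsMorphism q
  isOpenQuotientMap : IsOpenQuotientMap q
  eq_iff : ∀ z z' : Z, q z = q z' ↔ ∃ g : G, g • z = z'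
  exists_regular : ∀ U : Set Q, IsOpen U → ∀ h : Z → ℂ, Z.RegularOn (q ⁻¹' U) h →
    (∀ (g : G), ∀ z ∈ q ⁻¹' U, h (g • z) = h z) →
      ∃ f : Q → ℂ, Q.RegularOn U f ∧ ∀ z ∈ q ⁻¹' U, h z = f (q z)

end SpaceWithFunctions

/-! ## Grassmannians -/

section Grassmannian

universe u

variable (M : Type u) [AddCommGroup M] [Module ℂ M] (k : ℕ)

/-- The pairs `(A, C)` with `M = A ⊕ C` and `dim A = k`; each gives a standard affine chart of the
Grassmannian of `k`-dimensional subspaces of `M`. -/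
def GrassmannianChart : Type u :=
  {c : Submodule ℂ M × Submodule ℂ M // IsCompl c.1 c.2 ∧ Module.finrank ℂ c.1 = k}

variable {M k} in
/-- The chart of the Grassmannian given by `(A, C)`: it sends a linear map `h : A → C` to its graph
`{a + h a | a ∈ A}`. -/
def GrassmannianChart.graph (c : GrassmannianChart M k) (h : c.1.1 →ₗ[ℂ] c.1.2) :
    {U : Submodule ℂ M // Module.finrank ℂ U = k} :=
  ⟨LinearMap.range (c.1.1.subtype + c.1.2.subtype ∘ₗ h), by
    rw [LinearMap.finrank_range_of_inj, c.2.2]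
    rw [← LinearMap.ker_eq_bot, LinearMap.ker_eq_bot']
    intro a ha
    have h1 : (a : M) = -(h a : M) := eq_neg_of_add_eq_zero_left ha
    have h2 : (a : M) ∈ c.1.2 := h1 ▸ neg_mem (h a).2
    exact Subtype.ext (Submodule.disjoint_def.1 c.2.1.disjoint _ a.2 h2)⟩

/-- The topology on the Grassmannian glued from the charts: a set is open iff its preimage in
every chart is Zariski open. -/
abbrev grassmannianTopology : TopologicalSpace {U : Submodule ℂ M // Module.finrank ℂ U = k} :=
  ⨆ c : GrassmannianChart M k,
    TopologicalSpace.coinduced c.graph (zariskiTopology (c.1.1 →ₗ[ℂ] c.1.2))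

variable {M k} in
theorem GrassmannianChart.continuous_graph (c : GrassmannianChart M k) :
    @Continuous _ _ (zariskiTopology _) (grassmannianTopology M k) c.graph :=
  continuous_iff_coinduced_le.2 (le_iSup
    (fun c : GrassmannianChart M k =>
      TopologicalSpace.coinduced c.graph (zariskiTopology (c.1.1 →ₗ[ℂ] c.1.2))) c)

variable {M k} in
theorem isOpen_grassmannian_iff {O : Set {U : Submodule ℂ M // Module.finrank ℂ U = k}} :
    IsOpen[grassmannianTopology M k] O ↔
      ∀ c : GrassmannianChart M k, IsOpen[zariskiTopology _] (c.graph ⁻¹' O) := by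
  rw [grassmannianTopology, isOpen_iSup_iff]
  rfl

/-- The Grassmannian of `k`-dimensional subspaces of a finite-dimensional vector space `M`, glued
from its standard affine charts: a function is regular on an open set `O` iff its pullback to each
chart is regular on the preimage of `O`. -/
def grassmannian [Module.Finite ℂ M] : SpaceWithFunctions.{u} where
  carrier := {U : Submodule ℂ M // Module.finrank ℂ U = k}
  top := grassmannianTopology M k
  RegularAt U f := ∃ O : Set {U : Submodule ℂ M // Module.finrank ℂ U = k},
    IsOpen[grassmannianTopology M k] O ∧ U ∈ O ∧ ∀ c : GrassmannianChart M k,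
      (affineSpace (c.1.1 →ₗ[ℂ] c.1.2)).RegularOn (c.graph ⁻¹' O) (fun h => f (c.graph h))
  regularAt_const U a := ⟨Set.univ, @isOpen_univ _ (grassmannianTopology M k), trivial,
    fun c h _ => (affineSpace _).regularAt_const h a⟩
  regularAt_add := by
    rintro U f g ⟨O, hO, hU, hf⟩ ⟨O', hO', hU', hg⟩
    let := grassmannianTopology M k
    exact ⟨O ∩ O', hO.inter hO', ⟨hU, hU'⟩, fun c h hh =>
      (affineSpace _).regularAt_add h _ _ (hf c h hh.1) (hg c h hh.2)⟩
  regularAt_mul := by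
    rintro U f g ⟨O, hO, hU, hf⟩ ⟨O', hO', hU', hg⟩
    let := grassmannianTopology M k
    exact ⟨O ∩ O', hO.inter hO', ⟨hU, hU'⟩, fun c h hh =>
      (affineSpace _).regularAt_mul h _ _ (hf c h hh.1) (hg c h hh.2)⟩
  regularAt_congr := by
    rintro U f g hfg ⟨O, hO, hU, hf⟩
    let := grassmannianTopology M k
    obtain ⟨O', h', hO', hU'⟩ := eventually_nhds_iff.1 hfg
    refine ⟨O ∩ O', hO.inter hO', ⟨hU, hU'⟩, fun c h hh => ?_⟩
    refine (affineSpace _).regularAt_congr h _ _ ?_ (hf c h hh.1)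
    let := zariskiTopology (c.1.1 →ₗ[ℂ] c.1.2)
    have hopen : IsOpen (c.graph ⁻¹' O') := hO'.preimage c.continuous_graph
    exact Filter.mem_of_superset (hopen.mem_nhds hh.2) fun y hy => h' _ hy
  eventually_regularAt := by
    rintro U f ⟨O, hO, hU, hf⟩
    let := grassmannianTopology M k
    exact Filter.mem_of_superset (hO.mem_nhds hU) fun y hy => ⟨O, hO, hy, hf⟩
  eventually_ne := by
    rintro U f ⟨O, hO, hU, hf⟩ hfU
    let := grassmannianTopology M k
    have hopen : IsOpen {y | y ∈ O ∧ f y ≠ 0} := by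
      rw [isOpen_grassmannian_iff]
      intro c
      let := zariskiTopology (c.1.1 →ₗ[ℂ] c.1.2)
      rw [isOpen_iff_mem_nhds]
      intro h hh
      have h₁ : IsOpen (c.graph ⁻¹' O) := hO.preimage c.continuous_graph
      have h₂ := (affineSpace _).eventually_ne h _ (hf c h hh.1) hh.2
      exact Filter.inter_mem (h₁.mem_nhds hh.1) h₂
    exact Filter.mem_of_superset (hopen.mem_nhds ⟨hU, hfU⟩) fun y hy => hy.2
  regularAt_inv := by
    rintro U f ⟨O, hO, hU, hf⟩ hfU
    let := grassmannianTopology M k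
    refine ⟨{y | y ∈ O ∧ f y ≠ 0}, ?_, ⟨hU, hfU⟩, fun c h hh =>
      (affineSpace _).regularAt_inv h _ (hf c h hh.1) hh.2⟩
    rw [isOpen_grassmannian_iff]
    intro c
    let := zariskiTopology (c.1.1 →ₗ[ℂ] c.1.2)
    rw [isOpen_iff_mem_nhds]
    intro h hh
    have h₁ : IsOpen (c.graph ⁻¹' O) := hO.preimage c.continuous_graph
    have h₂ := (affineSpace _).eventually_ne h _ (hf c h hh.1) hh.2
    exact Filter.inter_mem (h₁.mem_nhds hh.1) h₂

/-- The Grassmannian of `k`-dimensional `A`-subrepresentations of a finite-dimensional `A`-module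
`M`, as a subvariety of the Grassmannian of `k`-dimensional subspaces of `M`. -/
def quiverGrassmannian (A : Type*) [Ring A] [Algebra ℂ A] [Module A M] [IsScalarTower ℂ A M]
    [Module.Finite ℂ M] : SpaceWithFunctions.{u} :=
  (grassmannian M k).restrict
    {U : {U : Submodule ℂ M // Module.finrank ℂ U = k} | ∀ (a : A), ∀ u ∈ U.1, a • u ∈ U.1}

end Grassmannian

/-! ## The truncated loop quiver and stable pairs -/

section LoopQuiver

universe u v

/-- The truncated polynomial ring `A_N = ℂ[t]/(t^N)`. -/
abbrev TruncatedPolynomial (N : ℕ) : Type :=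
  Polynomial ℂ ⧸ Ideal.span {(Polynomial.X : Polynomial ℂ) ^ N}

instance (N : ℕ) : Module.Finite ℂ (TruncatedPolynomial N) :=
  (Polynomial.monic_X_pow N).finite_quotient

/-- The class of `t` in `A_N`. -/
def TruncatedPolynomial.t (N : ℕ) : TruncatedPolynomial N :=
  Ideal.Quotient.mk _ Polynomial.X

/-- The variety `X^{(N)}_{k,m}` of `k`-dimensional `A_N`-submodules of the free `A_N`-module
`A_N ⊗ W`, where `m = dim W`. -/
def loopGrassmannian (N k : ℕ) (W : Type v) [AddCommGroup W] [Module ℂ W] [Module.Finite ℂ W] :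
    SpaceWithFunctions.{v} :=
  quiverGrassmannian (TruncatedPolynomial N ⊗[ℂ] W) k (TruncatedPolynomial N)

/-- The subspace of `A_N ⊗ W` underlying a point of `X^{(N)}_{k,m}`. -/
def loopGrassmannian.toSubmodule {N k : ℕ} {W : Type v} [AddCommGroup W] [Module ℂ W]
    [Module.Finite ℂ W] (x : loopGrassmannian N k W) :
    Submodule ℂ (TruncatedPolynomial N ⊗[ℂ] W) :=
  x.1.1

variable (N : ℕ) (V : Type u) (W : Type v) [AddCommGroup V] [Module ℂ V] [AddCommGroup W]
  [Module ℂ W]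

/-- The set of stable pairs `(φ, f)` with `φ^N = 0`. -/
def stablePairs : Set (Module.End ℂ V × (V →ₗ[ℂ] W)) :=
  {p | p.1 ^ N = 0 ∧ ⨅ i : ℕ, LinearMap.ker (p.2 ∘ₗ (p.1 ^ i : Module.End ℂ V)) = ⊥}

/-- The variety of stable pairs, a subvariety of the affine space `End(V) × Hom(V, W)`. -/
def stablePairSpace [Module.Finite ℂ V] [Module.Finite ℂ W] : SpaceWithFunctions.{max u v} :=
  (affineSpace (Module.End ℂ V × (V →ₗ[ℂ] W))).restrict (stablePairs N V W)

variable {N V W}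

/-- `φ` for a stable pair `(φ, f)`. -/
def stablePairSpace.endo [Module.Finite ℂ V] [Module.Finite ℂ W] (z : stablePairSpace N V W) :
    Module.End ℂ V :=
  z.1.1

/-- `f` for a stable pair `(φ, f)`. -/
def stablePairSpace.framing [Module.Finite ℂ V] [Module.Finite ℂ W] (z : stablePairSpace N V W) :
    V →ₗ[ℂ] W :=
  z.1.2

theorem conj_mem_stablePairs (g : LinearMap.GeneralLinearGroup ℂ V)
    {p : Module.End ℂ V × (V →ₗ[ℂ] W)} (hp : p ∈ stablePairs N V W) :
    ((g : Module.End ℂ V) * p.1 * (↑g⁻¹ : Module.End ℂ V), p.2 ∘ₗ (↑g⁻¹ : Module.End ℂ V)) ∈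
      stablePairs N V W := by
  refine ⟨by simp only [Units.conj_pow, hp.1, mul_zero, zero_mul], ?_⟩
  have h := hp.2
  rw [eq_bot_iff] at h ⊢
  intro x hx
  have hgi : ∀ y, (↑g⁻¹ : Module.End ℂ V) ((g : Module.End ℂ V) y) = y := fun y => by
    rw [← Module.End.mul_apply, ← Units.val_mul, inv_mul_cancel, Units.val_one,
      Module.End.one_apply]
  have hg : ∀ y, (g : Module.End ℂ V) ((↑g⁻¹ : Module.End ℂ V) y) = y := fun y => by
    rw [← Module.End.mul_apply, ← Units.val_mul, mul_inv_cancel, Units.val_one,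
      Module.End.one_apply]
  have h0 : (↑g⁻¹ : Module.End ℂ V) x ∈
      (⨅ i : ℕ, LinearMap.ker (p.2 ∘ₗ (p.1 ^ i : Module.End ℂ V))) := by
    rw [Submodule.mem_iInf] at hx ⊢
    intro i
    have hi := hx i
    simp only [Units.conj_pow, LinearMap.mem_ker, LinearMap.comp_apply, Module.End.mul_apply,
      hgi] at hi ⊢
    exact hi
  have h1 : (↑g⁻¹ : Module.End ℂ V) x = 0 := (Submodule.mem_bot ℂ).1 (h h0)
  rw [Submodule.mem_bot, ← hg x, h1, map_zero]

/-- The action `g • (φ, f) = (g φ g⁻¹, f g⁻¹)` of `GL(V)` on stable pairs. -/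
instance [Module.Finite ℂ V] [Module.Finite ℂ W] :
    MulAction (LinearMap.GeneralLinearGroup ℂ V) (stablePairSpace N V W) where
  smul g z := ⟨(g * z.1.1 * (↑g⁻¹ : Module.End ℂ V), z.1.2 ∘ₗ (↑g⁻¹ : Module.End ℂ V)),
    conj_mem_stablePairs g z.2⟩
  one_smul z := Subtype.ext (Prod.ext
    (by change (1 : Module.End ℂ V) * z.1.1 * 1 = z.1.1; rw [one_mul, mul_one]) rfl)
  mul_smul g h z := Subtype.ext (Prod.ext
    (by
      change (↑(g * h) : Module.End ℂ V) * z.1.1 * (↑(g * h)⁻¹ : Module.End ℂ V) =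
        (g : Module.End ℂ V) * ((h : Module.End ℂ V) * z.1.1 * (↑h⁻¹ : Module.End ℂ V)) *
          (↑g⁻¹ : Module.End ℂ V)
      rw [mul_inv_rev, Units.val_mul, Units.val_mul]
      simp only [mul_assoc])
    (by
      change z.1.2 ∘ₗ (↑(g * h)⁻¹ : Module.End ℂ V) =
        (z.1.2 ∘ₗ (↑h⁻¹ : Module.End ℂ V)) ∘ₗ (↑g⁻¹ : Module.End ℂ V)
      rw [mul_inv_rev, Units.val_mul]
      rfl))

variable (N) in
/-- The linear map `∑_{i < N} f φ^{N-1-i} t^i : V → A_N ⊗ W`. -/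
def loopMap (φ : Module.End ℂ V) (f : V →ₗ[ℂ] W) : V →ₗ[ℂ] TruncatedPolynomial N ⊗[ℂ] W :=
  ∑ i ∈ Finset.range N, TensorProduct.mk ℂ (TruncatedPolynomial N) W
    (TruncatedPolynomial.t N ^ i) ∘ₗ f ∘ₗ (φ ^ (N - 1 - i) : Module.End ℂ V)

end LoopQuiver

end

universe u v w

/-! An endomorphism `φ` with `φ ^ N = 0` makes `V` an `A_N`-module, and `A_N ⊗ W` is cofree over
`W`: taking the coefficient of `t ^ (N - 1)` identifies the `A_N`-linear maps `V → A_N ⊗ W` with the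
linear maps `f : V → W`. The inverse of this identification is `loopMap` (`loopMap_endo_apply`,
`topCoeffTensor_loopMap`, `loopMap_topCoeffTensor_comp`). The kernel of `loopMap N φ f` is the
largest `φ`-stable subspace of `ker f`, so stability of `(φ, f)` is injectivity of `loopMap N φ f`.
A stable pair is therefore an `A_N`-submodule of dimension `dim V` together with a linear
parametrisation of it by `V`, and `GL(V)` acts simply transitively on the parametrisations of a
given submodule. Thus the fibres of `π` are the orbits (`loopQuotientMap_eq_iff`).

For the geometry, the graph charts of the Grassmannian supply bases of the submodules that vary
regularly (`exists_local_frame`), which gives `π` a local section near every point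
(`exists_local_section`). An invariant morphism onto a variety with local sections and with the
orbits as fibres is a geometric quotient (`isGeometricQuotient_of_local_sections`): sections carry
neighbourhoods and invariant functions down to the base. The target is a variety because it is
closed in a Grassmannian, which is separated and covered by finitely many affine charts
(`isVariety_restrict_grassmannian`). Finally, invariant morphisms factor through a geometric
quotient, so two such quotients are isomorphic compatibly with the quotient maps
(`IsGeometricQuotient.exists_iso`). -/

namespace SpaceWithFunctions

variable {X : SpaceWithFunctions.{u}} {Y : SpaceWithFunctions.{v}} {Z : SpaceWithFunctions.{w}}

/-! ## Morphisms at a point -/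

/-- A map that is a morphism near a point. -/
structure IsMorphismAt (φ : X → Y) (x : X) : Prop where
  continuousAt : ContinuousAt φ x
  regular : ∀ f : Y → ℂ, Y.RegularAt (φ x) f → X.RegularAt x (fun y => f (φ y))

theorem isMorphism_iff {φ : X → Y} : IsMorphism φ ↔ ∀ x, IsMorphismAt φ x :=
  ⟨fun h x => ⟨h.continuous.continuousAt, h.regular x⟩,
    fun h => ⟨continuous_iff_continuousAt.2 fun x => (h x).continuousAt,
      fun x => (h x).regular⟩⟩

theorem IsMorphism.isMorphismAt {φ : X → Y} (h : IsMorphism φ) (x : X) : IsMorphismAt φ x :=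
  isMorphism_iff.1 h x

theorem IsMorphismAt.comp {φ : X → Y} {ψ : Y → Z} {x : X} (hψ : IsMorphismAt ψ (φ x))
    (hφ : IsMorphismAt φ x) : IsMorphismAt (fun y => ψ (φ y)) x :=
  ⟨ContinuousAt.comp (f := φ) (g := ψ) hψ.continuousAt hφ.continuousAt,
    fun f hf => hφ.regular _ (hψ.regular f hf)⟩

theorem IsMorphism.comp {φ : X → Y} {ψ : Y → Z} (hψ : IsMorphism ψ) (hφ : IsMorphism φ) :
    IsMorphism (fun y => ψ (φ y)) :=
  isMorphism_iff.2 fun x => (hψ.isMorphismAt _).comp (hφ.isMorphismAt x)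

theorem IsMorphismAt.congr {φ ψ : X → Y} {x : X} (h : IsMorphismAt φ x)
    (e : ∀ᶠ y in 𝓝 x, φ y = ψ y) : IsMorphismAt ψ x := by
  have ex := e.self_of_nhds
  refine ⟨h.continuousAt.congr e, fun f hf => ?_⟩
  refine X.regularAt_congr x (fun y => f (φ y)) _ ?_ (h.regular f (ex ▸ hf))
  filter_upwards [e] with y hy
  rw [hy]

theorem isMorphism_val (S : Set X) : IsMorphism (fun y : X.restrict S => (y.1 : X)) :=
  ⟨continuous_subtype_val, fun _ f hf => ⟨f, hf, .of_forall fun _ => rfl⟩⟩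

theorem IsMorphismAt.codRestrict {S : Set X} {φ : Y → X.restrict S} {y : Y}
    (h : IsMorphismAt (fun z => ((φ z).1 : X)) y) : IsMorphismAt φ y := by
  have hc : ContinuousAt φ y := Topology.IsInducing.subtypeVal.continuousAt_iff.2 h.continuousAt
  refine ⟨hc, ?_⟩
  rintro f ⟨F, hF, hf⟩
  refine Y.regularAt_congr y (fun z => F (φ z).1) _ ?_ (h.regular F hF)
  filter_upwards [hc.eventually hf] with z hz
  exact hz.symm

theorem IsMorphism.codRestrict {S : Set X} {φ : Y → X.restrict S}
    (h : IsMorphism (fun z => ((φ z).1 : X))) : IsMorphism φ :=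
  isMorphism_iff.2 fun y => (h.isMorphismAt y).codRestrict

/-! ## Sums and products of regular functions -/

theorem RegularAt.sum {ι : Type*} (s : Finset ι) {x : X} {f : ι → X → ℂ}
    (h : ∀ i ∈ s, X.RegularAt x (f i)) : X.RegularAt x (fun y => ∑ i ∈ s, f i y) := by
  classical
  induction s using Finset.induction_on with
  | empty => simpa using X.regularAt_const x 0
  | insert a s ha ih =>
    simp only [Finset.sum_insert ha]
    exact X.regularAt_add x _ _ (h a (Finset.mem_insert_self a s))
      (ih fun i hi => h i (Finset.mem_insert_of_mem hi))

theorem RegularAt.prod {ι : Type*} (s : Finset ι) {x : X} {f : ι → X → ℂ}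
    (h : ∀ i ∈ s, X.RegularAt x (f i)) : X.RegularAt x (fun y => ∏ i ∈ s, f i y) := by
  classical
  induction s using Finset.induction_on with
  | empty => simpa using X.regularAt_const x 1
  | insert a s ha ih =>
    simp only [Finset.prod_insert ha]
    exact X.regularAt_mul x _ _ (h a (Finset.mem_insert_self a s))
      (ih fun i hi => h i (Finset.mem_insert_of_mem hi))

theorem RegularAt.det {n : Type*} [Fintype n] [DecidableEq n] {x : X} {A : X → Matrix n n ℂ}
    (h : ∀ i j, X.RegularAt x (fun y => A y i j)) : X.RegularAt x (fun y => (A y).det) := by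
  simp only [Matrix.det_apply']
  exact .sum _ fun σ _ => X.regularAt_mul x _ _ (X.regularAt_const x _) (.prod _ fun i _ => h _ _)

/-- Cramer's rule: the entries of the adjugate are determinants of the matrix with one row replaced
by a constant row. -/
theorem RegularAt.matrix_inv {n : Type*} [Fintype n] [DecidableEq n] {x : X}
    {A : X → Matrix n n ℂ} (h : ∀ i j, X.RegularAt x (fun y => A y i j)) (hx : (A x).det ≠ 0)
    (i j : n) : X.RegularAt x (fun y => (A y)⁻¹ i j) := by
  simp only [Matrix.inv_def, Ring.inverse_eq_inv', Matrix.smul_apply, smul_eq_mul,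
    Matrix.adjugate_apply]
  refine X.regularAt_mul x _ _ (X.regularAt_inv x _ (.det h) hx) (.det fun a b => ?_)
  by_cases hab : a = j
  · subst hab
    simpa using X.regularAt_const x _
  · simpa [Matrix.updateRow_ne hab] using h a b

/-! ## Regular maps to vector spaces -/

section RegularMap

variable {E E' E'' : Type*} [AddCommGroup E] [Module ℂ E] [AddCommGroup E'] [Module ℂ E']
  [AddCommGroup E''] [Module ℂ E'']

/-- A map to a vector space whose composites with the linear forms are regular at `x`. -/
def RegularMapAt (F : X → E) (x : X) : Prop :=
  ∀ l : E →ₗ[ℂ] ℂ, X.RegularAt x (fun y => l (F y))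

namespace RegularMapAt

variable {F : X → E} {G : X → E'} {x : X}

theorem const (a : E) (x : X) : RegularMapAt (fun _ : X => a) x :=
  fun l => X.regularAt_const x (l a)

theorem add {F' : X → E} (hF : RegularMapAt F x) (hF' : RegularMapAt F' x) :
    RegularMapAt (fun y => F y + F' y) x := fun l => by
  simpa only [map_add] using X.regularAt_add x _ _ (hF l) (hF' l)

theorem linear (L : E →ₗ[ℂ] E') (hF : RegularMapAt F x) : RegularMapAt (fun y => L (F y)) x :=
  fun l => hF (l ∘ₗ L)

theorem sub {F' : X → E} (hF : RegularMapAt F x) (hF' : RegularMapAt F' x) :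
    RegularMapAt (fun y => F y - F' y) x := by
  simpa only [sub_eq_add_neg, LinearMap.neg_apply, LinearMap.id_apply] using
    hF.add (hF'.linear (-LinearMap.id))

theorem prodMk (hF : RegularMapAt F x) (hG : RegularMapAt G x) :
    RegularMapAt (fun y => (F y, G y)) x := by
  simpa using (hF.linear (LinearMap.inl ℂ E E')).add (hG.linear (LinearMap.inr ℂ E E'))

theorem of_basis {ι : Type*} [Fintype ι] (b : Module.Basis ι ℂ E)
    (h : ∀ i, X.RegularAt x (fun y => b.repr (F y) i)) : RegularMapAt F x := fun l => by
  have e : ∀ y, l (F y) = ∑ i, b.repr (F y) i * l (b i) := fun y => by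
    conv_lhs => rw [← b.sum_repr (F y)]
    simp only [map_sum, map_smul, smul_eq_mul]
  simp only [e]
  exact .sum _ fun i _ => X.regularAt_mul x _ _ (h i) (X.regularAt_const x _)

theorem bilinear [Module.Finite ℂ E] (B : E →ₗ[ℂ] E' →ₗ[ℂ] E'') (hF : RegularMapAt F x)
    (hG : RegularMapAt G x) : RegularMapAt (fun y => B (F y) (G y)) x := fun l => by
  let b := Module.finBasis ℂ E
  have e : ∀ y, l (B (F y) (G y)) = ∑ i, b.coord i (F y) * (l ∘ₗ B (b i)) (G y) := fun y => by
    conv_lhs => rw [← b.sum_repr (F y)]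
    simp only [map_sum, map_smul, LinearMap.sum_apply, LinearMap.smul_apply, smul_eq_mul,
      Module.Basis.coord_apply, LinearMap.comp_apply]
  simp only [e]
  exact .sum _ fun i _ => X.regularAt_mul x _ _ (hF _) (hG _)

theorem comp_linearMap {E₁ E₂ E₃ : Type*} [AddCommGroup E₁] [Module ℂ E₁] [AddCommGroup E₂]
    [Module ℂ E₂] [AddCommGroup E₃] [Module ℂ E₃] [Module.Finite ℂ E₁] [Module.Finite ℂ E₂]
    [Module.Finite ℂ E₃] {F : X → E₂ →ₗ[ℂ] E₃} {G : X → E₁ →ₗ[ℂ] E₂} (hF : RegularMapAt F x)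
    (hG : RegularMapAt G x) : RegularMapAt (fun y => F y ∘ₗ G y) x :=
  bilinear (LinearMap.llcomp ℂ E₁ E₂ E₃) hF hG

/-- Linear forms separate points, which reduces the claim to the non-vanishing of one regular
function. -/
theorem eventually_ne (hF : RegularMapAt F x) {a : E} (hx : F x ≠ a) :
    ∀ᶠ y in 𝓝 x, F y ≠ a := by
  have h : ¬ ∀ l : Module.Dual ℂ E, l (F x - a) = 0 := fun h =>
    hx (sub_eq_zero.1 ((Module.forall_dual_apply_eq_zero_iff ℂ _).1 h))
  obtain ⟨l, hl⟩ := not_forall.1 h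
  filter_upwards [X.eventually_ne x _ ((hF.sub (const a x)) l) hl] with y hy h
  exact hy (by rw [h, sub_self, map_zero])

theorem regularAt_polyFunction (hF : RegularMapAt F x) {p : E → ℂ} (hp : p ∈ polyFunctions E) :
    X.RegularAt x (fun y => p (F y)) := by
  induction hp using Algebra.adjoin_induction with
  | mem p hp =>
    obtain ⟨l, rfl⟩ := hp
    exact hF l
  | algebraMap r => exact X.regularAt_const x r
  | add p q _ _ hp hq => exact X.regularAt_add x _ _ hp hq
  | mul p q _ _ hp hq => exact X.regularAt_mul x _ _ hp hq

/-- Linear forms generate the polynomial functions, whose non-vanishing loci generate the topology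
and whose quotients are the regular functions. Testing against linear forms is thus enough. -/
theorem isMorphismAt [Module.Finite ℂ E] (hF : RegularMapAt F x) :
    IsMorphismAt (Y := affineSpace E) F x := by
  have hc : Filter.Tendsto F (𝓝 x) (@nhds E (zariskiTopology E) (F x)) := by
    rw [TopologicalSpace.tendsto_nhds_generateFrom_iff]
    rintro _ ⟨p, hp, rfl⟩ hx
    exact X.eventually_ne x _ (hF.regularAt_polyFunction hp) hx
  refine ⟨hc, ?_⟩
  rintro f ⟨p, hp, q, hq, hqx, hf⟩
  refine X.regularAt_congr x (fun y => p (F y) * (q (F y))⁻¹) _ ?_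
    (X.regularAt_mul x _ _ (hF.regularAt_polyFunction hp)
      (X.regularAt_inv x _ (hF.regularAt_polyFunction hq) hqx))
  filter_upwards [hc.eventually hf] with y hy
  rw [hy, div_eq_mul_inv]

theorem comp_isMorphismAt {F : Y → E} {φ : X → Y} (hF : RegularMapAt F (φ x))
    (hφ : IsMorphismAt φ x) : RegularMapAt (fun y => F (φ y)) x :=
  fun l => hφ.regular _ (hF l)

theorem congr {F' : X → E} (hF : RegularMapAt F x) (e : ∀ᶠ y in 𝓝 x, F y = F' y) :
    RegularMapAt F' x := fun l => by
  refine X.regularAt_congr x _ _ ?_ (hF l)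
  filter_upwards [e] with y hy
  rw [hy]

theorem eventually_isUnit [Module.Finite ℂ E] {G : X → Module.End ℂ E} (hG : RegularMapAt G x)
    (hx : IsUnit (G x)) : ∀ᶠ y in 𝓝 x, IsUnit (G y) := by
  let b := Module.finBasis ℂ E
  have h : ∀ y, IsUnit (G y) ↔ (LinearMap.toMatrix b b (G y)).det ≠ 0 := fun y => by
    rw [LinearMap.det_toMatrix, ← isUnit_iff_ne_zero, LinearMap.isUnit_iff_isUnit_det]
  simp only [h] at hx ⊢
  exact X.eventually_ne x _
    (.det fun i j => hG ((LinearMap.proj j ∘ₗ LinearMap.proj i) ∘ₗ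
      (LinearMap.toMatrix b b).toLinearMap)) hx

theorem inverse [Module.Finite ℂ E] {G : X → Module.End ℂ E} (hG : RegularMapAt G x)
    (hx : IsUnit (G x)) : RegularMapAt (fun y => Ring.inverse (G y)) x := by
  let b := Module.finBasis ℂ E
  have hx' : (LinearMap.toMatrix b b (G x)).det ≠ 0 := by
    rwa [LinearMap.det_toMatrix, ← isUnit_iff_ne_zero, ← LinearMap.isUnit_iff_isUnit_det]
  have h : RegularMapAt (fun y => (LinearMap.toMatrix b b (G y))⁻¹) x :=
    of_basis (Matrix.stdBasis ℂ _ _) fun ij => by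
      simpa [Matrix.stdBasis] using RegularAt.matrix_inv
        (A := fun y => LinearMap.toMatrix b b (G y)) (fun i j =>
          hG ((LinearMap.proj j ∘ₗ LinearMap.proj i) ∘ₗ (LinearMap.toMatrix b b).toLinearMap))
        hx' ij.1 ij.2
  -- Only the germ at `x` matters, and the units form a neighbourhood of `x` on which `Ring.inverse`
  -- is the genuine inverse.
  refine (h.linear (Matrix.toLin b b).toLinearMap).congr ?_
  filter_upwards [hG.eventually_isUnit hx] with y hy
  obtain ⟨g, hg⟩ := hy
  rw [← hg, Ring.inverse_unit]
  have h1 : LinearMap.toMatrix b b (g : Module.End ℂ E) *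
      LinearMap.toMatrix b b (↑g⁻¹ : Module.End ℂ E) = 1 := by
    rw [← LinearMap.toMatrix_mul, Units.mul_inv, LinearMap.toMatrix_one]
  rw [Matrix.inv_eq_right_inv h1]
  exact Matrix.toLin_toMatrix b b _

end RegularMapAt

theorem regularMapAt_affineSpace [Module.Finite ℂ E] (x : affineSpace E) :
    RegularMapAt (E := E) (fun y : affineSpace E => y) x := fun l =>
  ⟨l, Algebra.subset_adjoin ⟨l, rfl⟩, 1, Subalgebra.one_mem _, one_ne_zero,
    .of_forall fun _ => (div_one _).symm⟩

theorem isClosed_eq_of_regularMapAt {F : X → E} (hF : ∀ x, RegularMapAt F x) (a : E) :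
    IsClosed {x | F x = a} :=
  isOpen_compl_iff.1 (isOpen_iff_mem_nhds.2 fun x hx => (hF x).eventually_ne hx)

end RegularMap

/-! ## Uniqueness of geometric quotients -/

theorem RegularAt.exists_regularOn {x : X} {f : X → ℂ} (h : X.RegularAt x f) :
    ∃ U, IsOpen U ∧ x ∈ U ∧ X.RegularOn U f := by
  obtain ⟨U, hU, hUo, hx⟩ := eventually_nhds_iff.1 (X.eventually_regularAt x f h)
  exact ⟨U, hUo, hx, hU⟩

section GeometricQuotient

variable {G : Type*} [Group G] [MulAction G Z] {p : Z → X} {q : Z → Y}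

/-- Universal property of the quotient: for `f` regular on `U`, the function `f ∘ q` is invariant
and regular upstairs, hence descends, and surjectivity of `p` forces the descended function to be `f
∘ e` on the preimage of `U`. -/
theorem IsGeometricQuotient.isMorphism_of_comp (hp : IsGeometricQuotient G p)
    (hq : IsMorphism q) (hG : ∀ (g : G) z, q (g • z) = q z) {e : X → Y} (he : ∀ z, e (p z) = q z) :
    IsMorphism e := by
  have hep : e ∘ p = q := funext he
  refine ⟨hp.isOpenQuotientMap.isQuotientMap.continuous_iff.2 (hep ▸ hq.continuous), ?_⟩
  intro x f hf
  obtain ⟨z, rfl⟩ := hp.isOpenQuotientMap.surjective x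
  obtain ⟨U, hU, hzU, hfU⟩ := RegularAt.exists_regularOn hf
  have hc : Continuous e :=
    hp.isOpenQuotientMap.isQuotientMap.continuous_iff.2 (hep ▸ hq.continuous)
  obtain ⟨f', hf', hff'⟩ := hp.exists_regular (e ⁻¹' U) (hU.preimage hc) (fun z => f (q z))
    (fun y hy => hq.regular y f (he y ▸ hfU _ hy)) (fun g y _ => by rw [hG])
  refine X.regularAt_congr _ f' _ ?_ (hf' _ hzU)
  filter_upwards [(hU.preimage hc).mem_nhds hzU] with y hy
  obtain ⟨z', rfl⟩ := hp.isOpenQuotientMap.surjective y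
  rw [he, hff' z' hy]

theorem IsGeometricQuotient.exists_iso (hp : IsGeometricQuotient G p)
    (hq : IsGeometricQuotient G q) : ∃ e : Iso X Y, ∀ z, e.toEquiv (p z) = q z := by
  have hpq : ∀ z z', p z = p z' ↔ q z = q z' := fun z z' => (hp.eq_iff z z').trans
    (hq.eq_iff z z').symm
  have sp := Function.surjInv_eq hp.isOpenQuotientMap.surjective
  have sq := Function.surjInv_eq hq.isOpenQuotientMap.surjective
  let e : X ≃ Y :=
    { toFun x := q (Function.surjInv hp.isOpenQuotientMap.surjective x)
      invFun y := p (Function.surjInv hq.isOpenQuotientMap.surjective y)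
      left_inv x := by rw [← sp x, hpq, sq, sp x]
      right_inv y := by rw [← sq y, ← hpq, sp, sq y] }
  have he : ∀ z, e (p z) = q z := fun z => (hpq _ _).1 (sp _)
  have he' : ∀ z, e.symm (q z) = p z := fun z => by rw [← he, e.symm_apply_apply]
  exact ⟨⟨e, hp.isMorphism_of_comp hq.isMorphism (fun g z => ((hq.eq_iff _ _).2 ⟨g, rfl⟩).symm) he,
    hq.isMorphism_of_comp hp.isMorphism (fun g z => ((hp.eq_iff _ _).2 ⟨g, rfl⟩).symm) he'⟩, he⟩

end GeometricQuotient

end SpaceWithFunctions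

/-! ## Charts of the Grassmannian -/

section Charts

open SpaceWithFunctions

variable {M : Type u} [AddCommGroup M] [Module ℂ M] {k : ℕ}

namespace GrassmannianChart

variable (c : GrassmannianChart M k)

/-- The projection to the first summand of a chart. -/
noncomputable def fst : M →ₗ[ℂ] c.1.1 := c.1.1.projectionOnto c.1.2 c.2.1

/-- The projection to the second summand of a chart. -/
noncomputable def snd : M →ₗ[ℂ] c.1.2 := c.1.2.projectionOnto c.1.1 c.2.1.symm

theorem fst_add_snd (x : M) : (c.fst x : M) + c.snd x = x := by
  simpa [fst, snd] using Submodule.projection_add_projection_eq_self c.2.1 x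

/-- The map `a ↦ a + h a` with image the graph of `h`. -/
def frame (h : c.1.1 →ₗ[ℂ] c.1.2) : c.1.1 →ₗ[ℂ] M := c.1.1.subtype + c.1.2.subtype ∘ₗ h

theorem coe_graph (h : c.1.1 →ₗ[ℂ] c.1.2) : (c.graph h).1 = LinearMap.range (c.frame h) := rfl

@[simp]
theorem fst_frame (h : c.1.1 →ₗ[ℂ] c.1.2) (a : c.1.1) : c.fst (c.frame h a) = a := by
  simp [fst, frame]

@[simp]
theorem snd_frame (h : c.1.1 →ₗ[ℂ] c.1.2) (a : c.1.1) : c.snd (c.frame h a) = h a := by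
  simp [snd, frame]

theorem mem_graph_iff {h : c.1.1 →ₗ[ℂ] c.1.2} {x : M} :
    x ∈ (c.graph h).1 ↔ c.snd x = h (c.fst x) := by
  rw [coe_graph]
  constructor
  · rintro ⟨a, rfl⟩
    rw [fst_frame, snd_frame]
  · intro hx
    refine ⟨c.fst x, ?_⟩
    conv_rhs => rw [← c.fst_add_snd x, hx]
    rfl

theorem frame_fst {h : c.1.1 →ₗ[ℂ] c.1.2} {x : M} (hx : x ∈ (c.graph h).1) :
    c.frame h (c.fst x) = x := by
  conv_rhs => rw [← c.fst_add_snd x, c.mem_graph_iff.1 hx]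
  rfl

theorem graph_injective : Function.Injective c.graph := fun h h' e => by
  ext1 a
  have ha : c.frame h a ∈ (c.graph h').1 := e ▸ ⟨a, rfl⟩
  simpa using c.mem_graph_iff.1 ha

/-- The coordinates of a chart. -/
noncomputable def coord (U : {U : Submodule ℂ M // Module.finrank ℂ U = k}) : c.1.1 →ₗ[ℂ] c.1.2 :=
  Function.invFun c.graph U

@[simp]
theorem coord_graph (h : c.1.1 →ₗ[ℂ] c.1.2) : c.coord (c.graph h) = h :=
  Function.leftInverse_invFun c.graph_injective h

theorem graph_coord {U : {U : Submodule ℂ M // Module.finrank ℂ U = k}}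
    (hU : U ∈ Set.range c.graph) : c.graph (c.coord U) = U :=
  Function.invFun_eq hU

variable {V : Type*} [AddCommGroup V] [Module ℂ V] (e : V ≃ₗ[ℂ] c.1.1)

/-- The linear map whose graph is the image of `F`, if that image is a graph. -/
noncomputable def slope (F : V →ₗ[ℂ] M) : c.1.1 →ₗ[ℂ] c.1.2 :=
  (c.snd ∘ₗ F) ∘ₗ Ring.inverse (e.symm.toLinearMap ∘ₗ c.fst ∘ₗ F : Module.End ℂ V) ∘ₗ
    e.symm.toLinearMap

variable {c e} in
-- Reparametrising `F` so that its first component becomes the identity of `A` turns its second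
-- component into the slope. The inclusion of the image in the graph is then an equality by
-- dimension.
theorem range_eq_graph_slope [Module.Finite ℂ M] {F : V →ₗ[ℂ] M}
    (hF : IsUnit (e.symm.toLinearMap ∘ₗ c.fst ∘ₗ F : Module.End ℂ V)) :
    LinearMap.range F = (c.graph (c.slope e F)).1 := by
  have hinj : Function.Injective F := by
    have h := ((Module.End.isUnit_iff _).1 hF).injective
    exact Function.Injective.of_comp (f := fun x => e.symm (c.fst x)) h
  refine Submodule.eq_of_le_of_finrank_eq ?_ ?_
  · rintro _ ⟨v, rfl⟩
    rw [mem_graph_iff]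
    change _ = c.snd (F ((Ring.inverse _ * (e.symm.toLinearMap ∘ₗ c.fst ∘ₗ F : Module.End ℂ V)) v))
    rw [Ring.inverse_mul_cancel _ hF]
    rfl
  · rw [LinearMap.finrank_range_of_inj hinj, (c.graph _).2, e.finrank_eq, c.2.2]

variable {c} in
theorem isUnit_of_range_eq_graph [Module.Finite ℂ V] {F : V →ₗ[ℂ] M}
    {h : c.1.1 →ₗ[ℂ] c.1.2}
    (hF : LinearMap.range F = (c.graph h).1) :
    IsUnit (e.symm.toLinearMap ∘ₗ c.fst ∘ₗ F : Module.End ℂ V) := by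
  rw [LinearMap.isUnit_iff_range_eq_top, LinearMap.range_eq_top]
  intro v
  obtain ⟨x, hx⟩ : c.frame h (e v) ∈ LinearMap.range F := hF ▸ ⟨e v, rfl⟩
  exact ⟨x, by simp [hx]⟩

variable [Module.Finite ℂ M] [Module.Finite ℂ V]

theorem mem_range_graph_of_isCompl (U : {U : Submodule ℂ M // Module.finrank ℂ U = k})
    (hU : IsCompl U.1 c.1.2) : U ∈ Set.range c.graph := by
  let e : U.1 ≃ₗ[ℂ] c.1.1 := LinearEquiv.ofFinrankEq _ _ (U.2.trans c.2.2.symm)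
  have h : IsUnit (e.symm.toLinearMap ∘ₗ c.fst ∘ₗ U.1.subtype : Module.End ℂ U.1) := by
    rw [LinearMap.isUnit_iff_ker_eq_bot, LinearMap.ker_eq_bot']
    intro u hu
    have hu' : c.fst u = 0 := by simpa using hu
    have hC : (u : M) ∈ c.1.2 := (Submodule.projectionOnto_apply_eq_zero_iff c.2.1).1 hu'
    exact Subtype.ext (Submodule.disjoint_def.1 hU.disjoint _ u.2 hC)
  refine ⟨c.slope e U.1.subtype, Subtype.ext ?_⟩
  rw [← range_eq_graph_slope h, Submodule.range_subtype]

theorem exists_mem_range_graph (U : {U : Submodule ℂ M // Module.finrank ℂ U = k}) :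
    ∃ c : GrassmannianChart M k, U ∈ Set.range c.graph := by
  obtain ⟨C, hC⟩ := U.1.exists_isCompl
  exact ⟨⟨(U.1, C), hC, U.2⟩, mem_range_graph_of_isCompl _ U hC⟩

/-- The coordinate charts of a fixed basis of `M` suffice: every subspace has a complement spanned
by basis vectors. -/
theorem exists_finite_cover : ∃ 𝒞 : Set (GrassmannianChart M k), 𝒞.Finite ∧
    ∀ U : {U : Submodule ℂ M // Module.finrank ℂ U = k}, ∃ c ∈ 𝒞, U ∈ Set.range c.graph := by
  let b := Module.finBasis ℂ M
  let s : Set (Fin (Module.finrank ℂ M)) → Submodule ℂ M := fun T => Submodule.span ℂ (b '' T)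
  refine ⟨{c | ∃ T, c.1 = (s Tᶜ, s T)}, ?_, fun U => ?_⟩
  · refine Set.Finite.of_finite_image (f := Subtype.val) ?_ Subtype.val_injective.injOn
    refine (Set.finite_range fun T => (s Tᶜ, s T)).subset ?_
    rintro _ ⟨c, ⟨T, hT⟩, rfl⟩
    exact ⟨T, hT.symm⟩
  -- The basis vectors selected by `a` have classes forming a basis of `M ⧸ U`: independence makes
  -- their span disjoint from `U`, spanning makes it a supplement.
  · obtain ⟨κ, a, -, hspan, hli⟩ := exists_linearIndependent' ℂ (U.1.mkQ ∘ b)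
    have hTs : s (Set.range a) = Submodule.span ℂ (Set.range (b ∘ a)) := by
      rw [Set.range_comp]
    have hU : IsCompl U.1 (s (Set.range a)) := by
      refine ⟨?_, ?_⟩
      · rw [hTs]
        simpa using (Submodule.range_ker_disjoint (v := b ∘ a) (f := U.1.mkQ) hli).symm
      · rw [codisjoint_iff, hTs, sup_comm, ← Submodule.ker_mkQ U.1, ← Submodule.comap_map_eq,
          Submodule.map_span, ← Set.range_comp, ← Function.comp_assoc, hspan, Set.range_comp,
          ← Submodule.map_span, b.span_eq, Submodule.map_top, Submodule.range_mkQ,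
          Submodule.comap_top]
    have hc : IsCompl (s (Set.range a)ᶜ) (s (Set.range a)) := by
      refine ⟨b.linearIndependent.disjoint_span_image disjoint_compl_left, ?_⟩
      rw [codisjoint_iff, ← Submodule.span_union, ← Set.image_union, Set.compl_union_self,
        Set.image_univ, b.span_eq]
    have hk : Module.finrank ℂ (s (Set.range a)ᶜ) = k := by
      have h1 := Submodule.finrank_add_eq_of_isCompl hU
      have h2 := Submodule.finrank_add_eq_of_isCompl hc
      have h3 := U.2
      omega
    exact ⟨⟨_, hc, hk⟩, ⟨_, rfl⟩, mem_range_graph_of_isCompl _ U hU⟩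

/-! ### Regularity of the charts -/

variable {X : SpaceWithFunctions.{v}} {x : X}

theorem regularMapAt_slope {F : X → V →ₗ[ℂ] M} (hF : RegularMapAt F x)
    (hx : IsUnit (e.symm.toLinearMap ∘ₗ c.fst ∘ₗ F x : Module.End ℂ V)) :
    RegularMapAt (fun y => c.slope e (F y)) x :=
  ((RegularMapAt.const c.snd x).comp_linearMap hF).comp_linearMap
    ((((RegularMapAt.const e.symm.toLinearMap x).comp_linearMap
      ((RegularMapAt.const c.fst x).comp_linearMap hF)).inverse hx).comp_linearMap
        (RegularMapAt.const _ x))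

theorem eventually_isUnit {F : X → V →ₗ[ℂ] M} (hF : RegularMapAt F x)
    (hx : IsUnit (e.symm.toLinearMap ∘ₗ c.fst ∘ₗ F x : Module.End ℂ V)) :
    ∀ᶠ y in 𝓝 x, IsUnit (e.symm.toLinearMap ∘ₗ c.fst ∘ₗ F y : Module.End ℂ V) :=
  ((RegularMapAt.const e.symm.toLinearMap x).comp_linearMap
      ((RegularMapAt.const c.fst x).comp_linearMap hF)).eventually_isUnit hx

theorem regularMapAt_frame {h : X → c.1.1 →ₗ[ℂ] c.1.2} (hh : RegularMapAt h x) :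
    RegularMapAt (fun y => c.frame (h y)) x :=
  (RegularMapAt.const _ x).add ((RegularMapAt.const _ x).comp_linearMap hh)

theorem isMorphism_graph :
    IsMorphism (X := affineSpace (c.1.1 →ₗ[ℂ] c.1.2)) (Y := grassmannian M k) c.graph := by
  refine ⟨c.continuous_graph, ?_⟩
  rintro h f ⟨O, -, hO, hf⟩
  exact hf c h hO

/-- Seen in another chart `c'`, the image of `c` is the locus where the frame of `c'`, projected to
the first summand of `c`, is invertible. -/
theorem isOpen_range_graph : IsOpen (X := grassmannian M k) (Set.range c.graph) := by
  refine isOpen_grassmannian_iff.2 fun c' => ?_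
  refine (isOpen_iff_mem_nhds (X := affineSpace (c'.1.1 →ₗ[ℂ] c'.1.2))).2 ?_
  rintro h' ⟨h, hh⟩
  let e : c'.1.1 ≃ₗ[ℂ] c.1.1 := LinearEquiv.ofFinrankEq _ _ (c'.2.2.trans c.2.2.symm)
  have hu := isUnit_of_range_eq_graph (F := c'.frame h') e (congrArg Subtype.val hh.symm)
  filter_upwards [c.eventually_isUnit (X := affineSpace (c'.1.1 →ₗ[ℂ] c'.1.2)) e
    (c'.regularMapAt_frame (regularMapAt_affineSpace h')) hu] with y hy
  exact ⟨_, Subtype.ext (range_eq_graph_slope hy).symm⟩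

/-- The transition maps between charts are slopes of frames, and slopes depend regularly on the
frame. -/
theorem regularMapAt_coord {U : grassmannian M k} (hU : U ∈ Set.range c.graph) :
    RegularMapAt (X := grassmannian M k) c.coord U := fun l => by
  refine ⟨Set.range c.graph, c.isOpen_range_graph, hU, ?_⟩
  rintro c' h' ⟨h, hh⟩
  let e : c'.1.1 ≃ₗ[ℂ] c.1.1 := LinearEquiv.ofFinrankEq _ _ (c'.2.2.trans c.2.2.symm)
  have hu := isUnit_of_range_eq_graph (F := c'.frame h') e (congrArg Subtype.val hh.symm)
  have hr := c'.regularMapAt_frame (regularMapAt_affineSpace h')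
  refine (RegularMapAt.congr (c.regularMapAt_slope e hr hu) ?_) l
  filter_upwards [c.eventually_isUnit e hr hu] with y hy
  rw [← c.coord_graph (c.slope e (c'.frame y))]
  exact congrArg c.coord (Subtype.ext (range_eq_graph_slope hy).symm)

end GrassmannianChart

variable [Module.Finite ℂ M] {V : Type*} [AddCommGroup V] [Module ℂ V] [Module.Finite ℂ V]

/-- Near `x` the map is the slope of `F` followed by a chart. -/
theorem isMorphismAt_of_range_eq {X : SpaceWithFunctions.{v}} {x : X} {p : X → grassmannian M k}
    {F : X → V →ₗ[ℂ] M} (hk : Module.finrank ℂ V = k) (hF : RegularMapAt F x)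
    (h : ∀ y, (p y).1 = LinearMap.range (F y)) : IsMorphismAt p x := by
  obtain ⟨c, h', hc⟩ := GrassmannianChart.exists_mem_range_graph (p x)
  let e : V ≃ₗ[ℂ] c.1.1 := LinearEquiv.ofFinrankEq _ _ (hk.trans c.2.2.symm)
  have hu := GrassmannianChart.isUnit_of_range_eq_graph (F := F x) e (by rw [← h, hc])
  refine IsMorphismAt.congr ((c.isMorphism_graph.isMorphismAt _).comp
    (c.regularMapAt_slope e hF hu).isMorphismAt) ?_
  filter_upwards [c.eventually_isUnit e hF hu] with y hy
  exact Subtype.ext ((GrassmannianChart.range_eq_graph_slope hy).symm.trans (h y).symm)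

/-! ## Closed subvarieties of the Grassmannian -/

/-- Subspaces of equal dimension coincide as soon as one contains the other, and containment is
locally the vanishing of a regular map. Each subspace may be taken in its own chart, so no common
chart is needed. -/
theorem isClosed_eq_grassmannian {Y : SpaceWithFunctions.{v}} {φ ψ : Y → grassmannian M k}
    (hφ : IsMorphism φ) (hψ : IsMorphism ψ) : IsClosed {y | φ y = ψ y} := by
  rw [← isOpen_compl_iff, isOpen_iff_mem_nhds]
  intro y hy
  obtain ⟨c, hc⟩ := GrassmannianChart.exists_mem_range_graph (φ y)
  obtain ⟨d, hd⟩ := GrassmannianChart.exists_mem_range_graph (ψ y)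
  -- The bracket is a linear map with kernel `ψ z`, and the frame parametrises `φ z`, as long as
  -- both points stay in their charts.
  let T : Y → c.1.1 →ₗ[ℂ] d.1.2 := fun z =>
    (d.snd - d.coord (ψ z) ∘ₗ d.fst) ∘ₗ c.frame (c.coord (φ z))
  have hT : RegularMapAt T y :=
    ((RegularMapAt.const _ y).sub
      (((d.regularMapAt_coord hd).comp_isMorphismAt (hψ.isMorphismAt y)).comp_linearMap
        (RegularMapAt.const _ y))).comp_linearMap (c.regularMapAt_frame
          ((c.regularMapAt_coord hc).comp_isMorphismAt (hφ.isMorphismAt y)))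
  have key : ∀ z, φ z ∈ Set.range c.graph → ψ z ∈ Set.range d.graph →
      (T z = 0 ↔ (φ z).1 ≤ (ψ z).1) := fun z hz hz' => by
    conv_rhs => rw [← c.graph_coord hz, ← d.graph_coord hz', c.coe_graph]
    constructor
    · rintro h _ ⟨a, rfl⟩
      rw [d.mem_graph_iff]
      exact sub_eq_zero.1 (LinearMap.congr_fun h a)
    · intro h
      ext1 a
      exact sub_eq_zero.2 (d.mem_graph_iff.1 (h ⟨a, rfl⟩))
  have hy0 : T y ≠ 0 := fun h => hy (Subtype.ext (Submodule.eq_of_le_of_finrank_eq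
    ((key y hc hd).1 h) ((φ y).2.trans (ψ y).2.symm)))
  filter_upwards [hT.eventually_ne hy0, hφ.continuous.continuousAt.preimage_mem_nhds
    (c.isOpen_range_graph.mem_nhds hc), hψ.continuous.continuousAt.preimage_mem_nhds
    (d.isOpen_range_graph.mem_nhds hd)] with z hz hzc hzd h
  exact hz ((key z hzc hzd).2 (le_of_eq (congrArg Subtype.val h)))

variable {S : Set (grassmannian M k)}

theorem isAffine_restrict_range_graph (c : GrassmannianChart M k)
    (hS : IsClosed (X := affineSpace (c.1.1 →ₗ[ℂ] c.1.2)) (c.graph ⁻¹' S)) :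
    (((grassmannian M k).restrict S).restrict (Subtype.val ⁻¹' Set.range c.graph)).IsAffine := by
  let n := Module.finrank ℂ (c.1.1 →ₗ[ℂ] c.1.2)
  let L : (c.1.1 →ₗ[ℂ] c.1.2) ≃ₗ[ℂ] (Fin n → ℂ) := (Module.finBasis ℂ _).equivFun
  have hL : ∀ y, RegularMapAt (X := affineSpace (Fin n → ℂ)) L.symm y := fun y =>
    (regularMapAt_affineSpace y).linear L.symm.toLinearMap
  have hg : IsMorphism (X := affineSpace (Fin n → ℂ)) (Y := grassmannian M k)
      (fun y => c.graph (L.symm y)) :=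
    isMorphism_iff.2 fun y => (c.isMorphism_graph.isMorphismAt _).comp (hL y).isMorphismAt
  let T : Set (affineSpace (Fin n → ℂ)) := {y | c.graph (L.symm y) ∈ S}
  refine ⟨n, T, hS.preimage (isMorphism_iff.2 fun y => (hL y).isMorphismAt).continuous, ⟨?_⟩⟩
  refine ⟨⟨fun x => ⟨L (c.coord x.1.1), ?_⟩, fun y => ⟨⟨c.graph (L.symm y.1), y.2⟩, ⟨_, rfl⟩⟩,
    ?_, ?_⟩, ?_, ?_⟩
  · change c.graph (L.symm (L (c.coord x.1.1))) ∈ S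
    rw [L.symm_apply_apply, c.graph_coord x.2]
    exact x.1.2
  · intro x
    refine Subtype.ext (Subtype.ext ?_)
    change c.graph (L.symm (L (c.coord x.1.1))) = x.1.1
    rw [L.symm_apply_apply, c.graph_coord x.2]
  · intro y
    refine Subtype.ext ?_
    change L (c.coord (c.graph (L.symm y.1))) = y.1
    rw [c.coord_graph]
    exact L.apply_symm_apply y.1
  · refine IsMorphism.codRestrict (isMorphism_iff.2 fun x => ?_)
    have hv := ((isMorphism_val S).comp
      (isMorphism_val (Subtype.val ⁻¹' Set.range c.graph))).isMorphismAt x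
    refine (RegularMapAt.linear L.toLinearMap (RegularMapAt.comp_isMorphismAt ?_ hv)).isMorphismAt
    exact c.regularMapAt_coord x.2
  · exact IsMorphism.codRestrict (IsMorphism.codRestrict (hg.comp (isMorphism_val T)))

theorem isVariety_restrict_grassmannian (hS : ∀ c : GrassmannianChart M k,
    IsClosed (X := affineSpace (c.1.1 →ₗ[ℂ] c.1.2)) (c.graph ⁻¹' S)) :
    ((grassmannian M k).restrict S).IsVariety := by
  refine ⟨?_, fun Y φ ψ hφ hψ => ?_⟩
  · obtain ⟨𝒞, h𝒞, hcov⟩ := GrassmannianChart.exists_finite_cover (M := M) (k := k)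
    refine ⟨(fun c : GrassmannianChart M k => Subtype.val ⁻¹' Set.range c.graph) '' 𝒞,
      h𝒞.image _, ?_, ?_⟩
    · refine Set.eq_univ_of_forall fun x => ?_
      obtain ⟨c, hc, hx⟩ := hcov x.1
      exact ⟨_, ⟨c, hc, rfl⟩, hx⟩
    · rintro _ ⟨c, -, rfl⟩
      exact ⟨c.isOpen_range_graph.preimage continuous_subtype_val,
        isAffine_restrict_range_graph c (hS c)⟩
  · have h := isClosed_eq_grassmannian ((isMorphism_val S).comp hφ) ((isMorphism_val S).comp hψ)
    exact (Set.ext fun y => Subtype.ext_iff.symm) ▸ h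

end Charts

/-! ## Truncated polynomials -/

section Truncated

variable (N : ℕ)

namespace TruncatedPolynomial

theorem t_pow_eq_zero {n : ℕ} (h : N ≤ n) : t N ^ n = 0 := by
  rw [t, ← map_pow, Ideal.Quotient.eq_zero_iff_mem, Ideal.mem_span_singleton]
  exact pow_dvd_pow _ h

/-- The coefficient of `t ^ (N - 1)`; it is zero if `N = 0`. -/
noncomputable def topCoeff : TruncatedPolynomial N →ₗ[ℂ] ℂ :=
  if hN : 1 ≤ N then
    (Submodule.liftQ ((Ideal.span {(Polynomial.X : Polynomial ℂ) ^ N}).restrictScalars ℂ)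
      (Polynomial.lcoeff ℂ (N - 1)) (fun p hp => by
        have hp' : (Polynomial.X : Polynomial ℂ) ^ N ∣ p := Ideal.mem_span_singleton.1 hp
        exact Polynomial.X_pow_dvd_iff.1 hp' (N - 1) (by omega))) ∘ₗ
      (Submodule.Quotient.restrictScalarsEquiv ℂ
        (Ideal.span {(Polynomial.X : Polynomial ℂ) ^ N})).symm.toLinearMap
  else 0

variable {N}

theorem topCoeff_mk (hN : 1 ≤ N) (p : Polynomial ℂ) :
    topCoeff N (Ideal.Quotient.mk _ p) = p.coeff (N - 1) := by
  rw [topCoeff, dif_pos hN]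
  rfl

theorem topCoeff_t_pow (hN : 1 ≤ N) (n : ℕ) :
    topCoeff N (t N ^ n) = if N - 1 = n then 1 else 0 := by
  rw [t, ← map_pow, topCoeff_mk hN, Polynomial.coeff_X_pow]

theorem induction_on {motive : TruncatedPolynomial N → Prop} (a : TruncatedPolynomial N)
    (add : ∀ a b, motive a → motive b → motive (a + b))
    (smul_t_pow : ∀ (n : ℕ) (c : ℂ), motive (c • t N ^ n)) : motive a := by
  obtain ⟨p, rfl⟩ := Ideal.Quotient.mk_surjective a
  induction p using Polynomial.induction_on' with
  | add p q hp hq => rw [map_add]; exact add _ _ hp hq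
  | monomial n c =>
    have h : Ideal.Quotient.mk (Ideal.span {(Polynomial.X : Polynomial ℂ) ^ N})
        (Polynomial.monomial n c) = c • t N ^ n := by
      rw [← Polynomial.smul_X_eq_monomial, t, ← map_pow]
      rfl
    rw [h]
    exact smul_t_pow n c

/-- Multiplying by `t ^ (N - 1 - i)` moves the coefficient of `t ^ i` to the top degree. -/
theorem sum_topCoeff (hN : 1 ≤ N) (a : TruncatedPolynomial N) :
    ∑ i ∈ Finset.range N, topCoeff N (t N ^ (N - 1 - i) * a) • t N ^ i = a := by
  induction a using induction_on with
  | add a b ha hb =>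
    simp only [mul_add, map_add, add_smul, Finset.sum_add_distrib, ha, hb]
  | smul_t_pow n c =>
    simp only [mul_smul_comm, map_smul, ← pow_add, topCoeff_t_pow hN, smul_eq_mul, mul_ite,
      mul_one, mul_zero]
    by_cases hn : n < N
    · rw [Finset.sum_eq_single_of_mem n (Finset.mem_range.2 hn), if_pos (by omega)]
      intro i hi hin
      have := Finset.mem_range.1 hi
      rw [if_neg (by omega), zero_smul]
    · rw [t_pow_eq_zero N (not_lt.1 hn), smul_zero]
      refine Finset.sum_eq_zero fun i hi => ?_
      have := Finset.mem_range.1 hi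
      rw [if_neg (by omega), zero_smul]

theorem smul_mem_of_t_smul_mem {M : Type*} [AddCommGroup M] [Module ℂ M]
    [Module (TruncatedPolynomial N) M] [IsScalarTower ℂ (TruncatedPolynomial N) M]
    {U : Submodule ℂ M} (h : ∀ x ∈ U, t N • x ∈ U) (a : TruncatedPolynomial N) {x : M}
    (hx : x ∈ U) : a • x ∈ U := by
  induction a using induction_on with
  | add a b ha hb => rw [add_smul]; exact add_mem ha hb
  | smul_t_pow n c =>
    rw [smul_assoc]
    refine U.smul_mem c ?_
    induction n with
    | zero => rwa [pow_zero, one_smul]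
    | succ n ih => rw [pow_succ', mul_smul]; exact h _ ih

end TruncatedPolynomial

open TruncatedPolynomial

variable (W : Type v) [AddCommGroup W] [Module ℂ W]

/-- The coefficient of `t ^ (N - 1)` of an element of `A_N ⊗ W`. -/
noncomputable def topCoeffTensor : TruncatedPolynomial N ⊗[ℂ] W →ₗ[ℂ] W :=
  (TensorProduct.lid ℂ W).toLinearMap ∘ₗ LinearMap.rTensor W (topCoeff N)

variable {N W}

@[simp]
theorem topCoeffTensor_tmul (a : TruncatedPolynomial N) (w : W) :
    topCoeffTensor N W (a ⊗ₜ w) = topCoeff N a • w := by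
  simp [topCoeffTensor]

theorem sum_topCoeffTensor (hN : 1 ≤ N) (x : TruncatedPolynomial N ⊗[ℂ] W) :
    ∑ i ∈ Finset.range N, (t N ^ i) ⊗ₜ[ℂ] topCoeffTensor N W (t N ^ (N - 1 - i) • x) = x := by
  induction x using TensorProduct.induction_on with
  | zero => simp
  | tmul a w =>
    simp only [TensorProduct.smul_tmul', topCoeffTensor_tmul, smul_eq_mul]
    simp only [← TensorProduct.smul_tmul, ← TensorProduct.sum_tmul, sum_topCoeff hN]
  | add x y hx hy =>
    simp only [smul_add, map_add, TensorProduct.tmul_add, Finset.sum_add_distrib, hx, hy]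

/-! ## The linear map attached to a pair -/

variable {V : Type u} [AddCommGroup V] [Module ℂ V]

theorem loopMap_apply (φ : Module.End ℂ V) (f : V →ₗ[ℂ] W) (x : V) :
    loopMap N φ f x = ∑ i ∈ Finset.range N, (t N ^ i) ⊗ₜ[ℂ] f ((φ ^ (N - 1 - i)) x) := by
  simp [loopMap]

theorem topCoeffTensor_loopMap (hN : 1 ≤ N) (φ : Module.End ℂ V) (f : V →ₗ[ℂ] W) (x : V) :
    topCoeffTensor N W (loopMap N φ f x) = f x := by
  rw [loopMap_apply, map_sum, Finset.sum_eq_single_of_mem (N - 1) (Finset.mem_range.2 (by omega))]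
  · simp [topCoeff_t_pow hN]
  · intro i _ hi
    rw [topCoeffTensor_tmul, topCoeff_t_pow hN, if_neg (Ne.symm hi), zero_smul]

theorem loopMap_endo_apply {φ : Module.End ℂ V} (hφ : φ ^ N = 0) (f : V →ₗ[ℂ] W) (x : V) :
    loopMap N φ f (φ x) = t N • loopMap N φ f x := by
  rw [loopMap_apply, loopMap_apply, Finset.smul_sum]
  cases N with
  | zero => simp
  | succ n =>
    simp only [TensorProduct.smul_tmul', smul_eq_mul, ← pow_succ', Nat.add_sub_cancel]
    -- The two sums differ by an index shift. The unmatched terms are `i = 0` on the left, which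
    -- contains `φ ^ N = 0`, and the last one on the right, which contains `t ^ N = 0`.
    rw [Finset.sum_range_succ', Finset.sum_range_succ, t_pow_eq_zero (n + 1) le_rfl,
      TensorProduct.zero_tmul]
    have h0 : (φ ^ (n - 0)) (φ x) = 0 := by
      rw [Nat.sub_zero, ← Module.End.mul_apply, ← pow_succ, hφ, LinearMap.zero_apply]
    rw [h0, map_zero, TensorProduct.tmul_zero]
    refine congrArg (· + _) (Finset.sum_congr rfl fun i hi => ?_)
    have hi' := Finset.mem_range.1 hi
    rw [← Module.End.mul_apply, ← pow_succ, show n - (i + 1) + 1 = n - i by omega]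

theorem map_endo_pow_apply {φ : Module.End ℂ V} {F : V →ₗ[ℂ] TruncatedPolynomial N ⊗[ℂ] W}
    (h : ∀ x, F (φ x) = t N • F x) (n : ℕ) (x : V) : F ((φ ^ n) x) = t N ^ n • F x := by
  induction n with
  | zero => simp
  | succ n ih =>
    rw [pow_succ', Module.End.mul_apply, h, ih, pow_succ']
    exact (mul_smul (t N) (t N ^ n) (F x)).symm

/-- Cofreeness of `A_N ⊗ W`: by equivariance, the coefficient of `t ^ i` in `F x` is the top
coefficient of `F (φ ^ (N - 1 - i) x)`. -/
theorem loopMap_topCoeffTensor_comp (hN : 1 ≤ N) {φ : Module.End ℂ V}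
    {F : V →ₗ[ℂ] TruncatedPolynomial N ⊗[ℂ] W} (h : ∀ x, F (φ x) = t N • F x) :
    loopMap N φ (topCoeffTensor N W ∘ₗ F) = F := by
  ext1 x
  simp only [loopMap_apply, LinearMap.comp_apply, map_endo_pow_apply h]
  exact sum_topCoeffTensor hN _

/-- Equivariance writes `f (φ ^ i x)` as the top coefficient of `t ^ i • loopMap N φ f x`, so an
element of the kernel is killed by every `f φ ^ i`. -/
theorem loopMap_injective (hN : 1 ≤ N) {φ : Module.End ℂ V} {f : V →ₗ[ℂ] W}
    (h : (φ, f) ∈ stablePairs N V W) : Function.Injective (loopMap N φ f) := by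
  rw [← LinearMap.ker_eq_bot, LinearMap.ker_eq_bot']
  intro x hx
  rw [← Submodule.mem_bot ℂ, ← h.2, Submodule.mem_iInf]
  intro i
  rw [LinearMap.mem_ker, LinearMap.comp_apply, ← topCoeffTensor_loopMap hN φ f,
    map_endo_pow_apply (loopMap_endo_apply h.1 f), hx, smul_zero, map_zero]

theorem mem_stablePairs_of_injective (hN : 1 ≤ N) {φ : Module.End ℂ V}
    {F : V →ₗ[ℂ] TruncatedPolynomial N ⊗[ℂ] W} (h : ∀ x, F (φ x) = t N • F x)
    (hF : Function.Injective F) : (φ, topCoeffTensor N W ∘ₗ F) ∈ stablePairs N V W := by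
  refine ⟨LinearMap.ext fun x => hF ?_, eq_bot_iff.2 fun x hx => ?_⟩
  · rw [map_endo_pow_apply h, t_pow_eq_zero N le_rfl, LinearMap.zero_apply, map_zero]
    exact zero_smul (TruncatedPolynomial N) (F x)
  · rw [Submodule.mem_iInf] at hx
    rw [Submodule.mem_bot, ← map_eq_zero_iff F hF, ← loopMap_topCoeffTensor_comp hN h,
      loopMap_apply]
    refine Finset.sum_eq_zero fun i _ => ?_
    have hi : (topCoeffTensor N W ∘ₗ F) ((φ ^ (N - 1 - i)) x) = 0 := hx (N - 1 - i)
    rw [hi, TensorProduct.tmul_zero]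

theorem loopMap_conj (g : LinearMap.GeneralLinearGroup ℂ V) (φ : Module.End ℂ V)
    (f : V →ₗ[ℂ] W) :
    loopMap N ((g : Module.End ℂ V) * φ * (↑g⁻¹ : Module.End ℂ V))
      (f ∘ₗ (↑g⁻¹ : Module.End ℂ V)) = loopMap N φ f ∘ₗ (↑g⁻¹ : Module.End ℂ V) := by
  ext1 x
  have h : ∀ y, (↑g⁻¹ : Module.End ℂ V) ((g : Module.End ℂ V) y) = y := fun y => by
    rw [← Module.End.mul_apply, Units.inv_mul, Module.End.one_apply]
  simp only [LinearMap.comp_apply, loopMap_apply, Units.conj_pow, Module.End.mul_apply, h]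

/-- Two injective maps with the same image differ by an automorphism. -/
theorem exists_generalLinearGroup_of_range_eq {M : Type*} [AddCommGroup M] [Module ℂ M]
    {F F' : V →ₗ[ℂ] M} (hF : Function.Injective F) (hF' : Function.Injective F')
    (h : LinearMap.range F = LinearMap.range F') :
    ∃ g : LinearMap.GeneralLinearGroup ℂ V, ∀ x, F' ((g : Module.End ℂ V) x) = F x := by
  let e : V ≃ₗ[ℂ] V := (LinearEquiv.ofInjective F hF).trans
    ((LinearEquiv.ofEq _ _ h).trans (LinearEquiv.ofInjective F' hF').symm)
  refine ⟨LinearMap.GeneralLinearGroup.ofLinearEquiv e, fun x => ?_⟩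
  exact congrArg Subtype.val ((LinearEquiv.ofInjective F' hF').apply_symm_apply
    (LinearEquiv.ofEq _ _ h (LinearEquiv.ofInjective F hF x)))

end Truncated

/-! ## The quotient map -/

namespace SpaceWithFunctions

variable {X : SpaceWithFunctions.{w}} {x : X}

theorem RegularMapAt.sum {E : Type*} [AddCommGroup E] [Module ℂ E] {ι : Type*} (s : Finset ι)
    {F : ι → X → E} (h : ∀ i ∈ s, RegularMapAt (F i) x) :
    RegularMapAt (fun y => ∑ i ∈ s, F i y) x := fun l => by
  simp only [map_sum]
  exact .sum _ fun i hi => h i hi l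

theorem RegularMapAt.pow {V : Type*} [AddCommGroup V] [Module ℂ V] [Module.Finite ℂ V]
    {φ : X → Module.End ℂ V} (h : RegularMapAt φ x) (n : ℕ) :
    RegularMapAt (fun y => φ y ^ n) x := by
  induction n with
  | zero => simpa only [pow_zero] using RegularMapAt.const _ x
  | succ n ih =>
    simp only [pow_succ]
    exact ih.comp_linearMap h

end SpaceWithFunctions

section Quotient

open SpaceWithFunctions TruncatedPolynomial

variable {N : ℕ} {V : Type u} [AddCommGroup V] [Module ℂ V] [Module.Finite ℂ V]
  {W : Type v} [AddCommGroup W] [Module ℂ W] [Module.Finite ℂ W]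

theorem regularMapAt_loopMap {X : SpaceWithFunctions.{w}} {x : X} {φ : X → Module.End ℂ V}
    {f : X → V →ₗ[ℂ] W} (hφ : RegularMapAt φ x) (hf : RegularMapAt f x) :
    RegularMapAt (fun y => loopMap N (φ y) (f y)) x :=
  RegularMapAt.sum _ fun _ _ => (RegularMapAt.const _ x).comp_linearMap
    (hf.comp_linearMap (hφ.pow _))

theorem regularMapAt_endo (z : stablePairSpace N V W) :
    RegularMapAt (X := stablePairSpace N V W) stablePairSpace.endo z :=
  ((regularMapAt_affineSpace z.1).linear (LinearMap.fst ℂ _ _)).comp_isMorphismAt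
    ((isMorphism_val _).isMorphismAt z)

theorem regularMapAt_framing (z : stablePairSpace N V W) :
    RegularMapAt (X := stablePairSpace N V W) stablePairSpace.framing z :=
  ((regularMapAt_affineSpace z.1).linear (LinearMap.snd ℂ _ _)).comp_isMorphismAt
    ((isMorphism_val _).isMorphismAt z)

theorem isMorphismAt_stablePairSpace {X : SpaceWithFunctions.{w}} {x : X}
    {s : X → stablePairSpace N V W} (h₁ : RegularMapAt (fun y => stablePairSpace.endo (s y)) x)
    (h₂ : RegularMapAt (fun y => stablePairSpace.framing (s y)) x) : IsMorphismAt s x :=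
  IsMorphismAt.codRestrict
    (X := affineSpace (Module.End ℂ V × (V →ₗ[ℂ] W))) (S := stablePairs N V W)
    (h₁.prodMk h₂).isMorphismAt

theorem continuous_smul_stablePairSpace (g : LinearMap.GeneralLinearGroup ℂ V) :
    Continuous fun z : stablePairSpace N V W => g • z := by
  refine (isMorphism_iff.2 fun z => isMorphismAt_stablePairSpace ?_ ?_).continuous
  · exact ((RegularMapAt.const (g : Module.End ℂ V) z).comp_linearMap
      (regularMapAt_endo z)).comp_linearMap (RegularMapAt.const (↑g⁻¹ : Module.End ℂ V) z)
  · exact (regularMapAt_framing z).comp_linearMap (RegularMapAt.const (↑g⁻¹ : Module.End ℂ V) z)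

/-- The graph of `h` is the kernel of `c.snd - h ∘ₗ c.fst` and the image of `c.frame h`. Invariance
is therefore the vanishing of a composite that is regular in `h`. -/
theorem GrassmannianChart.isClosed_invariant {M : Type u} [AddCommGroup M] [Module ℂ M]
    [Module.Finite ℂ M] {k : ℕ} (c : GrassmannianChart M k) (T : Module.End ℂ M) :
    IsClosed (X := affineSpace (c.1.1 →ₗ[ℂ] c.1.2))
      {h | ∀ x ∈ (c.graph h).1, T x ∈ (c.graph h).1} := by
  have hc := isClosed_eq_of_regularMapAt (X := affineSpace (c.1.1 →ₗ[ℂ] c.1.2))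
    (F := fun h => (c.snd - h ∘ₗ c.fst) ∘ₗ T ∘ₗ c.frame h) (fun h =>
      ((RegularMapAt.const _ h).sub ((regularMapAt_affineSpace h).comp_linearMap
        (RegularMapAt.const _ h))).comp_linearMap ((RegularMapAt.const _ h).comp_linearMap
          (c.regularMapAt_frame (regularMapAt_affineSpace h)))) 0
  convert hc using 1
  ext h
  constructor
  · intro hh
    exact LinearMap.ext fun a => sub_eq_zero.2 (c.mem_graph_iff.1 (hh _ ⟨a, rfl⟩))
  · rintro hh _ ⟨y, rfl⟩
    exact c.mem_graph_iff.2 (sub_eq_zero.1 (LinearMap.congr_fun hh y))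

theorem quiverGrassmannian_isVariety (M : Type u) [AddCommGroup M] [Module ℂ M] (k : ℕ)
    (A : Type*) [Ring A] [Algebra ℂ A] [Module A M] [IsScalarTower ℂ A M] [Module.Finite ℂ M] :
    (quiverGrassmannian M k A).IsVariety := by
  refine isVariety_restrict_grassmannian fun c => ?_
  have h : ∀ a : A, IsClosed (X := affineSpace (c.1.1 →ₗ[ℂ] c.1.2))
      {h | ∀ x ∈ (c.graph h).1, a • x ∈ (c.graph h).1} := fun a =>
    c.isClosed_invariant (Algebra.lsmul ℂ ℂ M a)
  convert isClosed_iInter h using 1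
  ext x
  rw [Set.mem_iInter]
  rfl

/-- The map sending a stable pair `(φ, f)` to the image of `loopMap N φ f`. -/
noncomputable def loopQuotientMap (hN : 1 ≤ N) (z : stablePairSpace N V W) :
    loopGrassmannian N (Module.finrank ℂ V) W :=
  ⟨⟨LinearMap.range (loopMap N (stablePairSpace.endo z) (stablePairSpace.framing z)),
    LinearMap.finrank_range_of_inj (loopMap_injective hN z.2)⟩, fun a x hx => by
      refine smul_mem_of_t_smul_mem ?_ a hx
      rintro _ ⟨y, rfl⟩
      exact ⟨_, loopMap_endo_apply z.2.1 _ y⟩⟩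

theorem loopQuotientMap_isMorphism (hN : 1 ≤ N) :
    IsMorphism (loopQuotientMap hN : stablePairSpace N V W → _) :=
  IsMorphism.codRestrict (isMorphism_iff.2 fun z => isMorphismAt_of_range_eq rfl
    (regularMapAt_loopMap (regularMapAt_endo z) (regularMapAt_framing z)) fun _ => rfl)

theorem loopQuotientMap_eq_iff (hN : 1 ≤ N) (z z' : stablePairSpace N V W) :
    loopQuotientMap hN z = loopQuotientMap hN z' ↔
      ∃ g : LinearMap.GeneralLinearGroup ℂ V, g • z = z' := by
  constructor
  · intro h
    obtain ⟨g, hg⟩ := exists_generalLinearGroup_of_range_eq (loopMap_injective hN z.2)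
      (loopMap_injective hN z'.2) (congrArg (fun y => y.1.1) h)
    have hgi : ∀ y, (g : Module.End ℂ V) ((↑g⁻¹ : Module.End ℂ V) y) = y := fun y => by
      rw [← Module.End.mul_apply, Units.mul_inv, Module.End.one_apply]
    have hg' : ∀ x, loopMap N z.1.1 z.1.2 ((↑g⁻¹ : Module.End ℂ V) x) =
        loopMap N z'.1.1 z'.1.2 x := fun x => by rw [← hg, hgi]
    -- The automorphism `g` matches the two parametrisations. Both endomorphisms are multiplication
    -- by `t` read through an injective parametrisation, and both framings are its top coefficient,
    -- so `g` matches these too.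
    refine ⟨g, Subtype.ext (Prod.ext (LinearMap.ext fun x => loopMap_injective hN z'.2 ?_)
      (LinearMap.ext fun x => ?_))⟩
    · change loopMap N z'.1.1 z'.1.2 ((g : Module.End ℂ V) (z.1.1 ((↑g⁻¹ : Module.End ℂ V) x))) =
        loopMap N z'.1.1 z'.1.2 (z'.1.1 x)
      rw [hg, loopMap_endo_apply z.2.1, hg', loopMap_endo_apply z'.2.1]
    · change z.1.2 ((↑g⁻¹ : Module.End ℂ V) x) = z'.1.2 x
      rw [← topCoeffTensor_loopMap hN z.1.1, hg', topCoeffTensor_loopMap hN]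
  · rintro ⟨g, rfl⟩
    refine Subtype.ext (Subtype.ext ?_)
    change LinearMap.range (loopMap N z.1.1 z.1.2) = LinearMap.range (loopMap N
      ((g : Module.End ℂ V) * z.1.1 * (↑g⁻¹ : Module.End ℂ V)) (z.1.2 ∘ₗ (↑g⁻¹ : Module.End ℂ V)))
    rw [loopMap_conj, LinearMap.range_comp_of_range_eq_top]
    exact LinearMap.range_eq_top.2 ((Module.End.isUnit_iff _).1 g⁻¹.isUnit).surjective

/-- Near every point of a quiver Grassmannian, the subrepresentations `U` have frames `F y` that
vary regularly with `y`, and so does the action of an element of the algebra in these frames. -/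
theorem exists_local_frame {M : Type w} [AddCommGroup M] [Module ℂ M] [Module.Finite ℂ M]
    {A : Type*} [Ring A] [Algebra ℂ A] [Module A M] [IsScalarTower ℂ A M] (a : A)
    (x : quiverGrassmannian M (Module.finrank ℂ V) A) :
    ∃ (F : quiverGrassmannian M (Module.finrank ℂ V) A → V →ₗ[ℂ] M)
      (φ : quiverGrassmannian M (Module.finrank ℂ V) A → Module.End ℂ V),
      RegularMapAt F x ∧ RegularMapAt φ x ∧ ∀ᶠ y in 𝓝 x, Function.Injective (F y) ∧
        LinearMap.range (F y) = y.1.1 ∧ ∀ v, F y (φ y v) = a • F y v := by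
  obtain ⟨c, hc⟩ := GrassmannianChart.exists_mem_range_graph x.1
  let e : V ≃ₗ[ℂ] c.1.1 := LinearEquiv.ofFinrankEq _ _ c.2.2.symm
  let T : Module.End ℂ M := Algebra.lsmul ℂ ℂ M a
  let F : quiverGrassmannian M (Module.finrank ℂ V) A → V →ₗ[ℂ] M :=
    fun y => c.frame (c.coord y.1) ∘ₗ e.toLinearMap
  have hFr : RegularMapAt F x := by
    refine RegularMapAt.comp_linearMap (c.regularMapAt_frame
      (RegularMapAt.comp_isMorphismAt ?_ ((isMorphism_val _).isMorphismAt x)))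
      (RegularMapAt.const _ x)
    exact c.regularMapAt_coord hc
  -- Multiplication by `a` is read in the frame through the projection to the first summand. This
  -- loses nothing, since `a • F y v` stays in the graph and is determined by that projection.
  refine ⟨F, fun y => e.symm.toLinearMap ∘ₗ c.fst ∘ₗ T ∘ₗ F y, hFr,
    (RegularMapAt.const _ x).comp_linearMap ((RegularMapAt.const _ x).comp_linearMap
      ((RegularMapAt.const _ x).comp_linearMap hFr)), ?_⟩
  have hev : ∀ᶠ y in 𝓝 x, y.1 ∈ Set.range c.graph :=
    (c.isOpen_range_graph.preimage continuous_subtype_val).mem_nhds hc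
  filter_upwards [hev] with y hy
  have hrange : LinearMap.range (F y) = y.1.1 := by
    rw [LinearMap.range_comp_of_range_eq_top _ e.range, ← c.coe_graph, c.graph_coord hy]
  refine ⟨fun v v' h => ?_, hrange, fun v => ?_⟩
  · simpa [F] using congrArg c.fst h
  · change c.frame (c.coord y.1) (e (e.symm (c.fst (a • F y v)))) = _
    rw [e.apply_symm_apply, c.frame_fst]
    rw [c.graph_coord hy]
    exact y.2 _ _ (hrange ▸ ⟨v, rfl⟩)

/-- The quotient map has sections near every point. -/
theorem exists_local_section (hN : 1 ≤ N) (x : loopGrassmannian N (Module.finrank ℂ V) W) :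
    ∃ s : loopGrassmannian N (Module.finrank ℂ V) W → stablePairSpace N V W,
      IsMorphismAt s x ∧ ∀ᶠ y in 𝓝 x, loopQuotientMap hN (s y) = y := by
  classical
  obtain ⟨F, φ, hF, hφ, h⟩ := exists_local_frame (V := V) (t N) x
  have hmem : ∀ᶠ y in 𝓝 x, (φ y, topCoeffTensor N W ∘ₗ F y) ∈ stablePairs N V W := by
    filter_upwards [h] with y hy
    exact mem_stablePairs_of_injective hN hy.2.2 hy.1
  -- The section must be defined everywhere, so where the pair is not stable the pair at `x` serves
  -- as a default value. Near `x` this case does not occur.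
  let s : loopGrassmannian N (Module.finrank ℂ V) W → stablePairSpace N V W := fun y =>
    if hy : (φ y, topCoeffTensor N W ∘ₗ F y) ∈ stablePairs N V W then ⟨_, hy⟩
    else ⟨_, hmem.self_of_nhds⟩
  have hs : ∀ᶠ y in 𝓝 x, (s y).1 = (φ y, topCoeffTensor N W ∘ₗ F y) := by
    filter_upwards [hmem] with y hy
    exact congrArg Subtype.val (dif_pos hy)
  refine ⟨s, isMorphismAt_stablePairSpace (hφ.congr ?_)
    (RegularMapAt.congr ((RegularMapAt.const (topCoeffTensor N W) x).comp_linearMap hF) ?_), ?_⟩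
  · filter_upwards [hs] with y hy
    exact (congrArg Prod.fst hy).symm
  · filter_upwards [hs] with y hy
    exact (congrArg Prod.snd hy).symm
  · filter_upwards [hs, h] with y hy hyF
    refine Subtype.ext (Subtype.ext ?_)
    change LinearMap.range (loopMap N (s y).1.1 (s y).1.2) = y.1.1
    rw [hy, loopMap_topCoeffTensor_comp hN hyF.2.2, hyF.2.1]

end Quotient

/-! ### Geometric quotients from local sections -/

namespace SpaceWithFunctions

/-- An invariant morphism to a variety that has local sections and whose fibres are the orbits is a
geometric quotient. -/
theorem isGeometricQuotient_of_local_sections {G : Type*} [Group G]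
    {Z : SpaceWithFunctions.{u}} [MulAction G Z] {Q : SpaceWithFunctions.{v}} {q : Z → Q}
    (hQ : Q.IsVariety) (hq : IsMorphism q) (hG : ∀ g : G, Continuous fun z : Z => g • z)
    (hfib : ∀ z z' : Z, q z = q z' ↔ ∃ g : G, g • z = z')
    (hs : ∀ x : Q, ∃ s : Q → Z, IsMorphismAt s x ∧ ∀ᶠ y in 𝓝 x, q (s y) = y) :
    IsGeometricQuotient G q := by
  have hsurj : Function.Surjective q := fun x => by
    obtain ⟨s, -, h⟩ := hs x
    exact ⟨s x, h.self_of_nhds⟩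
  refine ⟨hQ, hq, ⟨hsurj, hq.continuous, fun O hO => ?_⟩, hfib, fun U hU h hh hinv => ?_⟩
  · rw [isOpen_iff_mem_nhds]
    rintro _ ⟨z, hz, rfl⟩
    obtain ⟨s, hsm, hsq⟩ := hs (q z)
    -- The section need not pass through `z`, but its translate by `g` does. Points near `q z` then
    -- lift into `O` along the translated section.
    obtain ⟨g, hg⟩ := (hfib (s (q z)) z).1 hsq.self_of_nhds
    have hO' : (fun z : Z => g • z) ⁻¹' O ∈ 𝓝 (s (q z)) :=
      (hO.preimage (hG g)).mem_nhds (by rwa [Set.mem_preimage, hg])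
    filter_upwards [hsm.continuousAt.preimage_mem_nhds hO', hsq] with y hy hyq
    exact ⟨_, hy, ((hfib _ _).2 ⟨g, rfl⟩).symm.trans hyq⟩
  · have hconst : ∀ z z', q z ∈ U → q z = q z' → h z = h z' := fun z z' hz hzz => by
      obtain ⟨g, rfl⟩ := (hfib z z').1 hzz
      exact (hinv g z hz).symm
    -- The descended function is defined through an arbitrary set-theoretic section. Invariance
    -- makes it equal near each point of `U` to `h ∘ s` for a local section `s`, which is regular.
    refine ⟨fun x => h (Function.surjInv hsurj x), fun x hx => ?_, fun z hz =>
      hconst _ _ hz (Function.surjInv_eq hsurj _).symm⟩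
    obtain ⟨s, hsm, hsq⟩ := hs x
    refine Q.regularAt_congr x (fun y => h (s y)) _ ?_ (hsm.regular h (hh _ ?_))
    · filter_upwards [hsq, hU.mem_nhds hx] with y hy hyU
      exact hconst _ _ (by rwa [hy]) (hy.trans (Function.surjInv_eq hsurj y).symm)
    · rwa [Set.mem_preimage, hsq.self_of_nhds]

end SpaceWithFunctions

theorem corollary3 (N : ℕ) (hN : 1 ≤ N)
    (V : Type u) [AddCommGroup V] [Module ℂ V] [Module.Finite ℂ V]
    (W : Type v) [AddCommGroup W] [Module ℂ W] [Module.Finite ℂ W] :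
    ∃ π : stablePairSpace N V W → loopGrassmannian N (Module.finrank ℂ V) W,
      (∀ z : stablePairSpace N V W,
        loopGrassmannian.toSubmodule (π z) =
          LinearMap.range (loopMap N (stablePairSpace.endo z) (stablePairSpace.framing z))) ∧
      SpaceWithFunctions.IsGeometricQuotient (LinearMap.GeneralLinearGroup ℂ V) π ∧
      ∀ (Q : SpaceWithFunctions.{w}) (q : stablePairSpace N V W → Q),
        SpaceWithFunctions.IsGeometricQuotient (LinearMap.GeneralLinearGroup ℂ V) q →
          ∃ e : SpaceWithFunctions.Iso (loopGrassmannian N (Module.finrank ℂ V) W) Q,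
            ∀ z : stablePairSpace N V W, e.toEquiv (π z) = q z := by
  have h : SpaceWithFunctions.IsGeometricQuotient (LinearMap.GeneralLinearGroup ℂ V)
      (loopQuotientMap hN : stablePairSpace N V W → _) :=
    SpaceWithFunctions.isGeometricQuotient_of_local_sections
      (quiverGrassmannian_isVariety _ _ _) (loopQuotientMap_isMorphism hN)
      continuous_smul_stablePairSpace (loopQuotientMap_eq_iff hN) (exists_local_section hN)
  exact ⟨loopQuotientMap hN, fun _ => rfl, h, fun _ _ hq => h.exists_iso hq⟩
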